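/- Let $n\ge 2$, $1<p<\infty$, let $\Omega\subset\mathbb R^n$ be a bounded open set, and let $m$ denote Lebesgue measure. Let $\sigma\in L^\infty_+(\Omega)$, i.e. $\sigma\in L^\infty(\Omega;\mathbb R)$ with $\operatorname{ess\,inf}_\Omega\sigma>0$, and assume that either $\sigma\ge 1$ a.e. in $\Omega$ or $\sigma\le 1$ a.e. in $\Omega$. Let $X:=W^{1,p}(\Omega)/W^{1,p}_0(\Omega)$, with dual $X'$. For $\gamma\in L^\infty_+(\Omega)$ and $f\in X$ let $u_\gamma^f$ be the unique minimizer of $u\mapsto\int_\Omega\gamma|\nabla u|^p\,dx$ in $f+W_0^{1,p}(\Omega)$. The Dirichlet–Neumann map $\Lambda_\gamma:X\to X'$ is defined by $$(\Lambda_\gamma(f),g)=\int_\Omega\gamma|\nabla u_\gamma^f|^{p-2}\nabla u_\gamma^f\cdot\nabla v^g\,dx,\qquad f,g\in X,$$ where $v^g\in W^{1,p}(\Omega)$ is any representative of $g$. Let $\Lambda_0$ and $u_0^f$ denote the Dirichlet–Neumann map and the minimizer for the constant conductivity $1$. For a measurable set $B\subseteq\Omega$ let $\Lambda_B$ be the operator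 that assigns to $f\in X$ the (for $p\ne2$ not necessarily linear) functional on $X$ $$(\Lambda_B(f),g)=\int_B|\nabla u_0^f|^{p-2}\nabla u_0^f\cdot\nabla u_0^g\,dx,\qquad g\in X.$$ For operators $\Lambda_1,\Lambda_2$ that assign to each $f\in X$ a functional on $X$, write $\Lambda_1\le\Lambda_2$ (equivalently $\Lambda_2\ge\Lambda_1$) if $(\Lambda_2(f)-\Lambda_1(f),f)\ge0$ for all $f\in X$. The essential support $\operatorname{esssupp}h$ of a measurable function $h:\Omega\to\mathbb R$ is the complement in $\Omega$ of the union of all open sets $O\subseteq\Omega$ on which $h=0$ a.e. The closed essential convex hull $\operatorname{cessco}A$ of a measurable set $A\subseteq\mathbb R^n$ is the intersection of all sets $H_{\rho,t}=\{x\in\mathbb R^n: x\cdot\rho\le t\}$, $\rho\in\mathbb R^n$, $t\in\mathbb R$, with $m(A\setminus H_{\rho,t})=0$. Let $B\subseteq\Omega$ be a measurable set with $m(B)>0$, and let $\alpha>0$. Then: (a) with $\tilde\alpha:=(p-1)\bigl(1-(1+\alpha)^{-1/(p-1)}\bigr)>0$, if $\sigma\ge1+\alpha$ a.e. on $B$,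 then $\Lambda_0+\tilde\alpha\Lambda_B\le\Lambda_\sigma$; (b) if $\sigma\le1-\alpha$ a.e. on $B$, then $\Lambda_0-\alpha\Lambda_B\ge\Lambda_\sigma$; (c) if $\Lambda_0+\alpha\Lambda_B\le\Lambda_\sigma$, then $m\bigl(B\setminus\operatorname{cessco}(\operatorname{esssupp}|\sigma-1|)\bigr)=0$; (d) if $\Lambda_0-\alpha\Lambda_B\ge\Lambda_\sigma$, then $m\bigl(B\setminus\operatorname{cessco}(\operatorname{esssupp}|\sigma-1|)\bigr)=0$. -/

import Mathlib

open MeasureTheory Set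
open scoped ENNReal ContDiff

noncomputable section

namespace PCalderon

/-- Euclidean space `ℝⁿ`. -/
abbrev E (n : ℕ) : Type := EuclideanSpace ℝ (Fin n)

instance factOneLeOfReal {p : ℝ} [hp : Fact (1 < p)] : Fact (1 ≤ ENNReal.ofReal p) :=
  ⟨by rw [← ENNReal.ofReal_one]; exact ENNReal.ofReal_le_ofReal hp.out.le⟩

/-! ### Essential support and closed essential convex hull -/

/-- The essential support of a function on `Ω`: the complement in `Ω` of the union of all open
sets `O ⊆ Ω` on which `f` vanishes almost everywhere. -/
def essSupp {n : ℕ} (Ω : Set (E n)) (f : E n → ℝ) : Set (E n) :=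
  Ω \ ⋃₀ {O : Set (E n) | IsOpen O ∧ O ⊆ Ω ∧ ∀ᵐ x ∂(volume.restrict O), f x = 0}

/-- The closed half-space `{x : x · ρ ≤ t}`; as usual in this definition of the hull, `ρ = 0` is
allowed. -/
def halfSpace {n : ℕ} (ρ : E n) (t : ℝ) : Set (E n) := {x | inner ℝ x ρ ≤ t}

/-- The closed essential convex hull: the intersection of all closed half-spaces that contain `A`
up to a Lebesgue null set. -/
def cessco {n : ℕ} (A : Set (E n)) : Set (E n) :=
  ⋂ (ρ : E n) (t : ℝ) (_ : volume (A \ halfSpace ρ t) = 0), halfSpace ρ t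

/-! ### Conductivities -/

/-- `σ ∈ L^∞₊(Ω)`: `σ` is essentially bounded on `Ω`, with positive essential infimum. -/
def IsConductivity {n : ℕ} (Ω : Set (E n)) (σ : E n → ℝ) : Prop :=
  MemLp σ ∞ (volume.restrict Ω) ∧ ∃ c : ℝ, 0 < c ∧ ∀ᵐ x ∂(volume.restrict Ω), c ≤ σ x

/-! ### Sobolev spaces -/

/-- Test functions: the elements of `C_c^∞(Ω)`. -/
structure IsTest {n : ℕ} (Ω : Set (E n)) (φ : E n → ℝ) : Prop where
  smooth : ContDiff ℝ ∞ φ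
  compact : HasCompactSupport φ
  subset : tsupport φ ⊆ Ω

/-- `G` is the weak gradient of `u` in `Ω`: `∫ u ∂_v φ = - ∫ φ (G · v)` for every test function
`φ` and every direction `v`. -/
def IsWeakGradient {n : ℕ} (Ω : Set (E n)) (u : E n → ℝ) (G : E n → E n) : Prop :=
  ∀ φ : E n → ℝ, IsTest Ω φ → ∀ v : E n,
    ∫ x in Ω, u x * fderiv ℝ φ x v = - ∫ x in Ω, φ x * inner ℝ (G x) v

lemma IsTest.integrable_deriv {n : ℕ} {Ω : Set (E n)} {φ u : E n → ℝ} (hφ : IsTest Ω φ)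
    (hu : LocallyIntegrable u (volume.restrict Ω)) (v : E n) :
    Integrable (fun x => u x * fderiv ℝ φ x v) (volume.restrict Ω) := by
  have hc : Continuous (fun x => fderiv ℝ φ x v) :=
    (hφ.smooth.continuous_fderiv (by simp)).clm_apply continuous_const
  have hs : HasCompactSupport (fun x => fderiv ℝ φ x v) := hφ.compact.fderiv_apply ℝ v
  simpa [mul_comm] using hu.integrable_smul_left_of_hasCompactSupport hc hs

lemma IsTest.integrable_mul {n : ℕ} {Ω : Set (E n)} {φ : E n → ℝ} {G : E n → E n}
    (hφ : IsTest Ω φ) (hG : LocallyIntegrable G (volume.restrict Ω)) (v : E n) :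
    Integrable (fun x => φ x * inner ℝ (G x) v) (volume.restrict Ω) := by
  have h := (hG.integrable_smul_left_of_hasCompactSupport hφ.smooth.continuous
    hφ.compact).inner_const (𝕜 := ℝ) v
  simpa [inner_smul_left] using h

/-- The Sobolev space `W^{1,p}(Ω)`, realised as the space of all pairs `(u, G)` with `u ∈ L^p(Ω)`,
`G ∈ L^p(Ω; ℝⁿ)` and `G` the weak gradient of `u` (`G` is determined by `u`, so that the pair is the
same thing as the function `u`). The norm inherited from the product is
`max ‖u‖_{L^p} ‖∇u‖_{L^p}`, one of the usual equivalent Sobolev norms. -/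
def W1p {n : ℕ} (Ω : Set (E n)) (p : ℝ) [Fact (1 < p)] :
    Submodule ℝ (Lp ℝ (ENNReal.ofReal p) (volume.restrict Ω) ×
      Lp (E n) (ENNReal.ofReal p) (volume.restrict Ω)) where
  carrier := {w | IsWeakGradient Ω w.1 w.2}
  zero_mem' := by
    intro φ _ v
    have h1 : ∀ᵐ x ∂(volume.restrict Ω),
        ((0 : Lp ℝ (ENNReal.ofReal p) (volume.restrict Ω)) : E n → ℝ) x * fderiv ℝ φ x v = 0 := by
      filter_upwards [Lp.coeFn_zero ℝ (ENNReal.ofReal p) (volume.restrict Ω)] with x hx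
      rw [hx, Pi.zero_apply, zero_mul]
    have h2 : ∀ᵐ x ∂(volume.restrict Ω),
        φ x * inner ℝ (((0 : Lp (E n) (ENNReal.ofReal p) (volume.restrict Ω)) : E n → E n) x) v
          = 0 := by
      filter_upwards [Lp.coeFn_zero (E n) (ENNReal.ofReal p) (volume.restrict Ω)] with x hx
      rw [hx, Pi.zero_apply, inner_zero_left, mul_zero]
    refine (integral_eq_zero_of_ae h1).trans ?_
    rw [zero_eq_neg]
    exact integral_eq_zero_of_ae h2
  add_mem' := by
    intro a b ha hb φ hφ v
    have hp : (1 : ℝ≥0∞) ≤ ENNReal.ofReal p := Fact.out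
    have ia := hφ.integrable_deriv ((Lp.memLp a.1).locallyIntegrable hp) v
    have ib := hφ.integrable_deriv ((Lp.memLp b.1).locallyIntegrable hp) v
    have ja := hφ.integrable_mul ((Lp.memLp a.2).locallyIntegrable hp) v
    have jb := hφ.integrable_mul ((Lp.memLp b.2).locallyIntegrable hp) v
    have h1 : ∀ᵐ x ∂(volume.restrict Ω), (a + b).1 x * fderiv ℝ φ x v
        = a.1 x * fderiv ℝ φ x v + b.1 x * fderiv ℝ φ x v := by
      filter_upwards [Lp.coeFn_add a.1 b.1] with x hx
      rw [Prod.fst_add, hx, Pi.add_apply, add_mul]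
    have h2 : ∀ᵐ x ∂(volume.restrict Ω), φ x * inner ℝ ((a + b).2 x) v
        = φ x * inner ℝ (a.2 x) v + φ x * inner ℝ (b.2 x) v := by
      filter_upwards [Lp.coeFn_add a.2 b.2] with x hx
      rw [Prod.snd_add, hx, Pi.add_apply, inner_add_left, mul_add]
    rw [integral_congr_ae h1, integral_congr_ae h2, integral_add ia ib, integral_add ja jb,
      ha φ hφ v, hb φ hφ v]
    ring
  smul_mem' := by
    intro c a ha φ hφ v
    have h1 : ∀ᵐ x ∂(volume.restrict Ω), (c • a).1 x * fderiv ℝ φ x v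
        = c * (a.1 x * fderiv ℝ φ x v) := by
      filter_upwards [Lp.coeFn_smul c a.1] with x hx
      rw [Prod.smul_fst, hx, Pi.smul_apply, smul_eq_mul, mul_assoc]
    have h2 : ∀ᵐ x ∂(volume.restrict Ω), φ x * inner ℝ ((c • a).2 x) v
        = c * (φ x * inner ℝ (a.2 x) v) := by
      filter_upwards [Lp.coeFn_smul c a.2] with x hx
      rw [Prod.smul_snd, hx, Pi.smul_apply, real_inner_smul_left]
      ring
    rw [integral_congr_ae h1, integral_congr_ae h2, integral_const_mul, integral_const_mul,
      ha φ hφ v]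
    ring

/-- The gradient of a Sobolev function, as a function on `ℝⁿ` (meaningful a.e. on `Ω`). -/
def grad {n : ℕ} {Ω : Set (E n)} {p : ℝ} [Fact (1 < p)] (u : W1p Ω p) : E n → E n := u.1.2

/-- `C_c^∞(Ω)` as a subspace of `W^{1,p}(Ω)`. -/
def testSubmodule {n : ℕ} (Ω : Set (E n)) (p : ℝ) [Fact (1 < p)] : Submodule ℝ (W1p Ω p) where
  carrier := {w | ∃ φ : E n → ℝ, IsTest Ω φ ∧ w.1.1 =ᵐ[volume.restrict Ω] φ}
  zero_mem' := ⟨0, ⟨contDiff_const, HasCompactSupport.zero, by simp [tsupport]⟩,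
    Lp.coeFn_zero _ _ _⟩
  add_mem' := by
    rintro a b ⟨φ, hφ, ha⟩ ⟨ψ, hψ, hb⟩
    refine ⟨φ + ψ, ⟨hφ.smooth.add hψ.smooth, hφ.compact.add hψ.compact,
      (tsupport_add φ ψ).trans (union_subset hφ.subset hψ.subset)⟩, ?_⟩
    exact (Lp.coeFn_add a.1.1 b.1.1).trans (ha.add hb)
  smul_mem' := by
    rintro c a ⟨φ, hφ, ha⟩
    refine ⟨c • φ, ⟨hφ.smooth.const_smul c, hφ.compact.smul_left (f := fun _ => c),
      (tsupport_smul_subset_right (fun _ => c) φ).trans hφ.subset⟩, ?_⟩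
    exact (Lp.coeFn_smul c a.1.1).trans (ha.const_smul c)

/-- `W₀^{1,p}(Ω)`: the closure of `C_c^∞(Ω)` in `W^{1,p}(Ω)`. -/
def W01p {n : ℕ} (Ω : Set (E n)) (p : ℝ) [Fact (1 < p)] : Submodule ℝ (W1p Ω p) :=
  (testSubmodule Ω p).topologicalClosure

/-- The space of abstract boundary values `X = W^{1,p}(Ω) / W₀^{1,p}(Ω)`, with the quotient norm.
Its dual `X'` is `StrongDual ℝ (X Ω p)`. -/
abbrev X {n : ℕ} (Ω : Set (E n)) (p : ℝ) [Fact (1 < p)] : Type := W1p Ω p ⧸ W01p Ω p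

/-- The boundary value of a Sobolev function. -/
abbrev trace {n : ℕ} {Ω : Set (E n)} {p : ℝ} [Fact (1 < p)] (u : W1p Ω p) : X Ω p :=
  (W01p Ω p).mkQ u

/-! ### The Dirichlet problem and the nonlinear Dirichlet-Neumann map -/

/-- The `p`-Dirichlet energy `E_σ(u) = ∫_Ω σ |∇u|^p dx`. -/
def energy {n : ℕ} {Ω : Set (E n)} {p : ℝ} [Fact (1 < p)] (σ : E n → ℝ) (u : W1p Ω p) : ℝ :=
  ∫ x in Ω, σ x * ‖grad u x‖ ^ p

/-- `u` minimizes the energy `E_σ` among all functions with boundary value `f`. -/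
def IsMinimizer {n : ℕ} {Ω : Set (E n)} {p : ℝ} [Fact (1 < p)] (σ : E n → ℝ) (f : X Ω p)
    (u : W1p Ω p) : Prop :=
  trace u = f ∧ ∀ v : W1p Ω p, trace v = f → energy σ u ≤ energy σ v

/-- `u_σ^f`, the minimizer of `E_σ` with boundary value `f` (for bounded open `Ω` and
`σ ∈ L^∞₊(Ω)` it exists and is unique). -/
def solution {n : ℕ} {Ω : Set (E n)} {p : ℝ} [Fact (1 < p)] (σ : E n → ℝ) (f : X Ω p) : W1p Ω p :=
  Classical.epsilon (IsMinimizer σ f)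

/-- `∫_S σ |∇u|^{p-2} ∇u · ∇v dx`. Where `∇u = 0` the integrand is `0`, also for `p < 2`. -/
def fluxForm {n : ℕ} {Ω : Set (E n)} {p : ℝ} [Fact (1 < p)] (S : Set (E n)) (σ : E n → ℝ)
    (u v : W1p Ω p) : ℝ :=
  ∫ x in S, σ x * (‖grad u x‖ ^ (p - 2) * inner ℝ (grad u x) (grad v x))

/-- The nonlinear Dirichlet-Neumann map `Λ_σ : X → X'`: `Λ_σ(f)` is the element of `X'` with
`(Λ_σ(f), g) = ∫_Ω σ |∇u_σ^f|^{p-2} ∇u_σ^f · ∇v dx` for every `g ∈ X` and every representative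
`v ∈ W^{1,p}(Ω)` of `g`. There is at most one such functional, and for bounded open `Ω` and
`σ ∈ L^∞₊(Ω)` there is one. -/
def dnMap {n : ℕ} (Ω : Set (E n)) (p : ℝ) [Fact (1 < p)] (σ : E n → ℝ) (f : X Ω p) :
    StrongDual ℝ (X Ω p) :=
  Classical.epsilon fun ℓ : StrongDual ℝ (X Ω p) =>
    ∀ v : W1p Ω p, ℓ (trace v) = fluxForm Ω σ (solution σ f) v

/-- An operator that assigns to each `f ∈ X` a functional on `X`, given by its pairing
`(f, g) ↦ (Λ(f), g)`. Linearity in `g` is not required: `(Λ_B(f), g)` below is not linear in `g`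
when `p ≠ 2`. -/
abbrev Operator {n : ℕ} (Ω : Set (E n)) (p : ℝ) [Fact (1 < p)] : Type := X Ω p → X Ω p → ℝ

/-- The Dirichlet-Neumann map `Λ_σ`, given by its pairing. -/
def dnOp {n : ℕ} (Ω : Set (E n)) (p : ℝ) [Fact (1 < p)] (σ : E n → ℝ) : Operator Ω p :=
  fun f g => dnMap Ω p σ f g

/-- The test operator `(Λ_B(f), g) = ∫_B |∇u₀^f|^{p-2} ∇u₀^f · ∇u₀^g dx`, where `u₀^h` is the
minimizer with boundary value `h` for the conductivity `1`. -/
def testOp {n : ℕ} (Ω : Set (E n)) (p : ℝ) [Fact (1 < p)] (B : Set (E n)) : Operator Ω p :=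
  fun f g => fluxForm B (fun _ => 1) (solution (fun _ => 1) f) (solution (fun _ => 1) g)

/-- The preorder on operators: `Λ₁ ≤ Λ₂` iff `((Λ₂(f) - Λ₁(f)), f) ≥ 0` for all `f ∈ X`. -/
def OpLE {n : ℕ} {Ω : Set (E n)} {p : ℝ} [Fact (1 < p)] (Λ₁ Λ₂ : Operator Ω p) : Prop :=
  ∀ f : X Ω p, 0 ≤ (Λ₂ f - Λ₁ f) f

end PCalderon

end

open PCalderon

/-! Pairing `dnMap` at f with f itself gives the minimal energy, so each operator inequality
compares the energies of u = u_0^f and v = u_σ^f. Two bounds do the work. Since u competes with v,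
E_σ(v) - E_1(u) ≤ ∫ (σ - 1)|∇u|^p. Conversely, v - u lies in W_0^{1,p}, so the Euler-Lagrange
equation gives E_1(u) = ∫ |∇u|^{p-2}∇u·∇v, and Young's inequality with the pointwise weight σ
(`mul_rpow_mul_inner_le`, `IsMinimizer.mul_energy_le`) yields E_σ(v) - E_1(u) ≥ (p-1) ∫ (1 -
σ^{-1/(p-1)})|∇u|^p. Parts (a) and (b) follow by estimating these integrands on B and off B.

For (c) and (d) the same bounds turn the hypothesis into α ∫_B |∇u|^p ≤ ∫_Ω k|∇u|^p for all
minimizers u of conductivity 1, with a bounded k that vanishes where σ = 1. If B is not essentially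
inside the hull, there are ρ and t < t' such that σ = 1 a.e. in Ω where x·ρ > t, while B has a
non-null part where x·ρ > t' (`exists_separating_halfSpace`). The p-Laplace equation has solutions
exp(τ x·ρ) a(τ x·η), with η orthogonal to ρ and of the same length, whose gradients are comparable
to τ|ρ| exp(τ x·ρ) with constants depending only on p (`exists_exponential_solution`). The ratio of
the left side to the right is then at least a constant times exp(pτ(t'-t)), which for large τ is a
contradiction (`exists_concentrating_solution`).

Since `solution` and `dnMap` are chosen by `Classical.epsilon`, the Dirichlet problem has to be
solved (`exists_isMinimizer`): uniform convexity of the energy and the Poincaré inequality make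
minimizing sequences Cauchy. Uniqueness of the gradient (`IsMinimizer.grad_ae_eq`) identifies the
exponential solutions with the chosen minimizers. -/

noncomputable section

namespace PCalderon

/-! ### Pointwise inequalities for the p-th power of the norm -/

section Pointwise

variable {V : Type*} [NormedAddCommGroup V] [InnerProductSpace ℝ V] {p : ℝ}

lemma abs_rpow_mul_inner_le (p : ℝ) (a b : V) :
    |‖a‖ ^ (p - 2) * inner ℝ a b| ≤ ‖a‖ ^ (p - 1) * ‖b‖ := by
  rcases eq_or_ne a 0 with rfl | ha
  · rw [inner_zero_left, mul_zero, abs_zero]; positivity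
  · have h : 0 < ‖a‖ := norm_pos_iff.2 ha
    have h1 : ‖a‖ ^ (p - 1) = ‖a‖ ^ (p - 2) * ‖a‖ := by
      rw [← Real.rpow_add_one h.ne']; congr 1; ring
    rw [abs_mul, abs_of_nonneg (by positivity), h1, mul_assoc]
    gcongr
    exact abs_real_inner_le_norm a b

lemma rpow_mul_inner_self (hp : 1 < p) (a : V) : ‖a‖ ^ (p - 2) * inner ℝ a a = ‖a‖ ^ p := by
  rcases eq_or_ne a 0 with rfl | ha
  · rw [inner_zero_left, mul_zero, norm_zero, Real.zero_rpow (by linarith)]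
  · have h : 0 < ‖a‖ := norm_pos_iff.2 ha
    rw [real_inner_self_eq_norm_sq, ← Real.rpow_natCast, ← Real.rpow_add h]
    congr 1; push_cast; ring

/-- For p < 2 the first factor is singular at the origin; the bound ‖a‖^(p-1)‖b‖ forces the product
to 0 there because p > 1. -/
lemma continuous_rpow_mul_inner (hp : 1 < p) (b : V) :
    Continuous fun a : V => ‖a‖ ^ (p - 2) * inner ℝ a b := by
  rw [continuous_iff_continuousAt]
  intro a
  rcases eq_or_ne a 0 with rfl | ha
  · have h0 : Filter.Tendsto (fun a : V => ‖a‖ ^ (p - 1) * ‖b‖) (nhds 0) (nhds 0) := by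
      have : Continuous fun a : V => ‖a‖ ^ (p - 1) * ‖b‖ :=
        (continuous_norm.rpow_const fun _ => Or.inr (by linarith)).mul continuous_const
      simpa [Real.zero_rpow (by linarith : p - 1 ≠ 0)] using this.tendsto 0
    unfold ContinuousAt
    beta_reduce
    rw [inner_zero_left, mul_zero]
    exact squeeze_zero_norm (fun a => abs_rpow_mul_inner_le p a b) h0
  · exact (continuousAt_id.norm.rpow_const (Or.inl (norm_ne_zero_iff.2 ha))).mul
      (continuousAt_id.inner continuousAt_const)

/-- Young's inequality with a weight `s`. -/
lemma mul_rpow_mul_inner_le (hp : 1 < p) {s : ℝ} (hs : 0 < s) (a b : V) :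
    p * (‖a‖ ^ (p - 2) * inner ℝ a b) ≤
      s * ‖b‖ ^ p + (p - 1) * s ^ (-(1 / (p - 1))) * ‖a‖ ^ p := by
  have hp0 : 0 < p := by linarith
  have hp1 : 0 < p - 1 := by linarith
  have h1 := (le_abs_self _).trans (abs_rpow_mul_inner_le p a b)
  have hpq : p.HolderConjugate (p / (p - 1)) := Real.HolderConjugate.conjExponent hp
  -- The powers of `s` cancel in the product, while the p-th power of the first factor carries
  -- exactly `s`.
  have h2 := Real.young_inequality_of_nonneg (a := s ^ (1 / p) * ‖b‖)
    (b := s ^ (-(1 / p)) * ‖a‖ ^ (p - 1)) (by positivity) (by positivity) hpq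
  have e1 : (s ^ (1 / p) * ‖b‖) ^ p = s * ‖b‖ ^ p := by
    rw [Real.mul_rpow (by positivity) (by positivity), ← Real.rpow_mul hs.le,
      one_div_mul_cancel hp0.ne', Real.rpow_one]
  have e2 : (s ^ (-(1 / p)) * ‖a‖ ^ (p - 1)) ^ (p / (p - 1)) =
      s ^ (-(1 / (p - 1))) * ‖a‖ ^ p := by
    rw [Real.mul_rpow (by positivity) (by positivity), ← Real.rpow_mul hs.le,
      ← Real.rpow_mul (norm_nonneg a)]
    congr 2 <;> field_simp
  have e3 : s ^ (1 / p) * ‖b‖ * (s ^ (-(1 / p)) * ‖a‖ ^ (p - 1)) = ‖a‖ ^ (p - 1) * ‖b‖ := by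
    have : s ^ (1 / p) * s ^ (-(1 / p)) = 1 := by
      rw [← Real.rpow_add hs, add_neg_cancel, Real.rpow_zero]
    linear_combination (‖a‖ ^ (p - 1) * ‖b‖) * this
  rw [e1, e2, e3] at h2
  calc p * (‖a‖ ^ (p - 2) * inner ℝ a b) ≤ p * (‖a‖ ^ (p - 1) * ‖b‖) := by gcongr
    _ ≤ p * (s * ‖b‖ ^ p / p + s ^ (-(1 / (p - 1))) * ‖a‖ ^ p / (p / (p - 1))) := by gcongr
    _ = _ := by field_simp

/-- The `p`-th power of the norm lies above its tangents. -/
lemma rpow_norm_add_le (hp : 1 < p) (a b : V) :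
    ‖a‖ ^ p + p * (‖a‖ ^ (p - 2) * inner ℝ a (b - a)) ≤ ‖b‖ ^ p := by
  have h := mul_rpow_mul_inner_le hp one_pos a b
  rw [Real.one_rpow] at h
  rw [inner_sub_right, mul_sub, rpow_mul_inner_self hp]
  linarith

/-- Strictness has two sources. For equal norms the triangle inequality is strict, as equality would
put the vectors on one ray; for different norms t ↦ t^p is strictly convex. -/
lemma rpow_midpoint_lt (hp : 1 < p) {a b : V} (hab : a ≠ b) :
    ‖(1 / 2 : ℝ) • (a + b)‖ ^ p < (‖a‖ ^ p + ‖b‖ ^ p) / 2 := by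
  have hn : ‖(1 / 2 : ℝ) • (a + b)‖ = 1 / 2 * ‖a + b‖ := by rw [norm_smul]; norm_num
  rw [hn]
  by_cases h : ‖a‖ = ‖b‖
  · have h1 : ‖a + b‖ < ‖a‖ + ‖b‖ := by
      refine lt_of_le_of_ne (norm_add_le a b) fun h2 => hab ?_
      exact (sameRay_iff_norm_add.2 h2).eq_of_norm_eq h
    have : (1 / 2 * ‖a + b‖) ^ p < ‖b‖ ^ p :=
      Real.rpow_lt_rpow (by positivity) (by linarith) (by linarith)
    rw [h]; linarith
  · have h1 := (strictConvexOn_rpow hp).2 (norm_nonneg a) (norm_nonneg b) h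
      (half_pos one_pos) (half_pos one_pos) (add_halves 1)
    simp only [smul_eq_mul] at h1
    have : (1 / 2 * ‖a + b‖) ^ p ≤ (1 / 2 * ‖a‖ + 1 / 2 * ‖b‖) ^ p :=
      Real.rpow_le_rpow (by positivity) (by linarith [norm_add_le a b]) (by linarith)
    linarith

lemma rpow_midpoint_le (hp : 1 < p) (a b : V) :
    ‖(1 / 2 : ℝ) • (a + b)‖ ^ p ≤ (‖a‖ ^ p + ‖b‖ ^ p) / 2 := by
  rcases eq_or_ne a b with rfl | h
  · rw [← two_smul ℝ a, smul_smul]; norm_num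
  · exact (rpow_midpoint_lt hp h).le

/-- A quantitative form of the uniform convexity of the `p`-th power of the norm. -/
lemma exists_rpow_norm_sub_le [FiniteDimensional ℝ V] (hp : 1 < p) {ε : ℝ} (hε : 0 < ε) :
    ∃ C : ℝ, 0 ≤ C ∧ ∀ a b : V, ‖a - b‖ ^ p ≤ ε * (‖a‖ ^ p + ‖b‖ ^ p) +
      C * ((‖a‖ ^ p + ‖b‖ ^ p) / 2 - ‖(1 / 2 : ℝ) • (a + b)‖ ^ p) := by
  have hp0 : 0 < p := by linarith
  have hc : ∀ f : V × V → V, Continuous f → Continuous fun z => ‖f z‖ ^ p := fun f hf =>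
    hf.norm.rpow_const fun _ => Or.inr hp0.le
  have c1 := hc (fun z => z.1) continuous_fst
  have c2 := hc (fun z => z.2) continuous_snd
  have c3 := hc (fun z => z.1 - z.2) (continuous_fst.sub continuous_snd)
  have c4 := hc (fun z => (1 / 2 : ℝ) • (z.1 + z.2))
    ((continuous_fst.add continuous_snd).const_smul _)
  -- All terms are homogeneous of degree p, so the pair may be normalized. On the compact set `K`
  -- the midpoint deficit is positive, hence bounded below by some `δ`; off `K` the term with `ε`
  -- already suffices.
  set K : Set (V × V) := {z | ‖z.1‖ ^ p + ‖z.2‖ ^ p = 1 ∧ ε ≤ ‖z.1 - z.2‖ ^ p} with hK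
  have le_one : ∀ x y : V, ‖x‖ ^ p + ‖y‖ ^ p = 1 → ‖x‖ ≤ 1 := by
    intro x y h
    by_contra hx
    have := Real.one_lt_rpow (not_le.1 hx) hp0
    have : 0 ≤ ‖y‖ ^ p := by positivity
    linarith
  have Kc : IsCompact K := by
    refine Metric.isCompact_of_isClosed_isBounded ?_ ?_
    · exact (isClosed_eq (c1.add c2) continuous_const).inter (isClosed_le continuous_const c3)
    · refine (Metric.isBounded_closedBall (x := (0 : V × V)) (r := 1)).subset fun z hz => ?_
      rw [mem_closedBall_zero_iff, Prod.norm_def, max_le_iff]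
      exact ⟨le_one _ _ hz.1, le_one z.2 z.1 (by rw [add_comm]; exact hz.1)⟩
  have hcont : Continuous fun z : V × V =>
      (‖z.1‖ ^ p + ‖z.2‖ ^ p) / 2 - ‖(1 / 2 : ℝ) • (z.1 + z.2)‖ ^ p :=
    ((c1.add c2).div_const 2).sub c4
  obtain ⟨δ, hδ, hδK⟩ : ∃ δ : ℝ, 0 < δ ∧ ∀ z ∈ K,
      δ ≤ (‖z.1‖ ^ p + ‖z.2‖ ^ p) / 2 - ‖(1 / 2 : ℝ) • (z.1 + z.2)‖ ^ p := by
    rcases K.eq_empty_or_nonempty with h | h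
    · exact ⟨1, one_pos, by simp [h]⟩
    · obtain ⟨z, hz, hm⟩ := Kc.exists_isMinOn h hcont.continuousOn
      refine ⟨_, ?_, fun w hw => hm hw⟩
      have hne : z.1 ≠ z.2 := by
        intro h
        have := hz.2
        rw [h, sub_self, norm_zero, Real.zero_rpow hp0.ne'] at this
        linarith
      linarith [rpow_midpoint_lt hp hne]
  have key : ∀ a b : V, ‖a‖ ^ p + ‖b‖ ^ p = 1 → ‖a - b‖ ^ p ≤ ε * (‖a‖ ^ p + ‖b‖ ^ p) +
      2 ^ p / δ * ((‖a‖ ^ p + ‖b‖ ^ p) / 2 - ‖(1 / 2 : ℝ) • (a + b)‖ ^ p) := by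
    intro a b h
    by_cases h1 : ε ≤ ‖a - b‖ ^ p
    · have h2 := hδK (a, b) ⟨h, h1⟩
      have h3 : ‖a - b‖ ^ p ≤ 2 ^ p := by
        refine Real.rpow_le_rpow (norm_nonneg _) ?_ hp0.le
        have := norm_sub_le a b
        have := le_one a b h
        have := le_one b a (by rw [add_comm]; exact h)
        linarith
      have h4 : 2 ^ p / δ * δ ≤ 2 ^ p / δ *
        ((‖a‖ ^ p + ‖b‖ ^ p) / 2 - ‖(1 / 2 : ℝ) • (a + b)‖ ^ p) := by gcongr
      rw [div_mul_cancel₀ _ hδ.ne'] at h4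
      rw [h] at h4 ⊢
      linarith
    · have := rpow_midpoint_le hp a b
      have h4 : 0 ≤ 2 ^ p / δ *
        ((‖a‖ ^ p + ‖b‖ ^ p) / 2 - ‖(1 / 2 : ℝ) • (a + b)‖ ^ p) :=
        mul_nonneg (by positivity) (by linarith)
      rw [h] at h4 ⊢
      linarith [not_le.1 h1]
  refine ⟨2 ^ p / δ, by positivity, fun a b => ?_⟩
  set S := ‖a‖ ^ p + ‖b‖ ^ p with hS
  have ha0 : 0 ≤ ‖a‖ ^ p := by positivity
  have hb0 : 0 ≤ ‖b‖ ^ p := by positivity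
  rcases (add_nonneg ha0 hb0).eq_or_lt with h | h
  · have h1 : ‖a‖ ^ p = 0 := by linarith
    have h2 : ‖b‖ ^ p = 0 := by linarith
    rw [Real.rpow_eq_zero (norm_nonneg _) hp0.ne', norm_eq_zero] at h1 h2
    simp [hS, h1, h2, Real.zero_rpow hp0.ne']
  -- Scaling by S^(-1/p) brings the sum of the p-th powers to 1.
  · set t := S ^ (-(1 / p)) with ht
    have ht0 : 0 < t := Real.rpow_pos_of_pos h _
    have htp : t ^ p = S⁻¹ := by
      rw [ht, ← Real.rpow_mul h.le, neg_mul, one_div_mul_cancel hp0.ne', Real.rpow_neg_one]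
    have hsm : ∀ x : V, ‖t • x‖ ^ p = S⁻¹ * ‖x‖ ^ p := fun x => by
      rw [norm_smul, Real.norm_of_nonneg ht0.le, Real.mul_rpow ht0.le (norm_nonneg _), htp]
    have h1 := key (t • a) (t • b) (by
      rw [hsm, hsm, ← mul_add]; exact inv_mul_cancel₀ h.ne')
    rw [← smul_sub, ← smul_add, smul_comm, hsm, hsm, hsm, hsm] at h1
    have h2 := mul_le_mul_of_nonneg_left h1 h.le
    have hSS : S * S⁻¹ = 1 := mul_inv_cancel₀ h.ne'
    calc ‖a - b‖ ^ p = S * (S⁻¹ * ‖a - b‖ ^ p) := by rw [← mul_assoc, hSS, one_mul]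
      _ ≤ _ := h2
      _ = S * S⁻¹ * (ε * (‖a‖ ^ p + ‖b‖ ^ p) + 2 ^ p / δ *
        ((‖a‖ ^ p + ‖b‖ ^ p) / 2 - ‖(1 / 2 : ℝ) • (a + b)‖ ^ p)) := by ring
      _ = _ := by rw [hSS, one_mul]

end Pointwise

/-! ### Energy, flux form and the Euler-Lagrange equation -/

section Energy

variable {n : ℕ} {Ω : Set (E n)} {p : ℝ} [hp : Fact (1 < p)]

lemma memLp_grad (u : W1p Ω p) : MemLp (grad u) (ENNReal.ofReal p) (volume.restrict Ω) :=
  Lp.memLp u.1.2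

lemma grad_add (u v : W1p Ω p) :
    ∀ᵐ x ∂(volume.restrict Ω), grad (u + v) x = grad u x + grad v x :=
  Lp.coeFn_add u.1.2 v.1.2

lemma grad_sub (u v : W1p Ω p) :
    ∀ᵐ x ∂(volume.restrict Ω), grad (u - v) x = grad u x - grad v x :=
  Lp.coeFn_sub u.1.2 v.1.2

lemma grad_smul (c : ℝ) (u : W1p Ω p) :
    ∀ᵐ x ∂(volume.restrict Ω), grad (c • u) x = c • grad u x :=
  Lp.coeFn_smul c u.1.2

lemma grad_neg (u : W1p Ω p) :
    ∀ᵐ x ∂(volume.restrict Ω), grad (-u) x = -grad u x :=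
  Lp.coeFn_neg u.1.2

lemma toReal_ofReal_of_fact : (ENNReal.ofReal p).toReal = p :=
  ENNReal.toReal_ofReal (by linarith [hp.out])

lemma ofReal_ne_zero_of_fact : ENNReal.ofReal p ≠ 0 := by
  simpa using (by linarith [hp.out] : 0 < p)

lemma integrable_rpow_of_memLp {F : Type*} [NormedAddCommGroup F] {f : E n → F} {μ : Measure (E n)}
    (hf : MemLp f (ENNReal.ofReal p) μ) : Integrable (fun x => ‖f x‖ ^ p) μ := by
  simpa only [toReal_ofReal_of_fact] using
    hf.integrable_norm_rpow ofReal_ne_zero_of_fact ENNReal.ofReal_ne_top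

lemma integrable_rpow_grad (u : W1p Ω p) :
    Integrable (fun x => ‖grad u x‖ ^ p) (volume.restrict Ω) :=
  integrable_rpow_of_memLp (memLp_grad u)

lemma norm_rpow_Lp {F : Type*} [NormedAddCommGroup F] {μ : Measure (E n)}
    (f : Lp F (ENNReal.ofReal p) μ) : ‖f‖ ^ p = ∫ x, ‖f x‖ ^ p ∂μ := by
  have hp0 : 0 < p := by linarith [hp.out]
  have h0 : 0 ≤ ∫ x, ‖f x‖ ^ p ∂μ := integral_nonneg fun x => by positivity
  rw [Lp.norm_def, (Lp.memLp f).eLpNorm_eq_integral_rpow_norm ofReal_ne_zero_of_fact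
    ENNReal.ofReal_ne_top, toReal_ofReal_of_fact (p := p), ENNReal.toReal_ofReal (by positivity),
    ← Real.rpow_mul h0, inv_mul_cancel₀ hp0.ne', Real.rpow_one]

lemma IsConductivity.integrable_mul {σ : E n → ℝ} (hσ : IsConductivity Ω σ) {f : E n → ℝ}
    (hf : Integrable f (volume.restrict Ω)) :
    Integrable (fun x => σ x * f x) (volume.restrict Ω) :=
  hf.mul_of_top_right hσ.1

lemma IsConductivity.nonneg {σ : E n → ℝ} (hσ : IsConductivity Ω σ) :
    ∀ᵐ x ∂(volume.restrict Ω), 0 ≤ σ x := by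
  obtain ⟨c, hc, h⟩ := hσ.2
  filter_upwards [h] with x hx using hc.le.trans hx

lemma isConductivity_one : IsConductivity Ω (fun _ => (1 : ℝ)) :=
  ⟨memLp_top_const 1, 1, one_pos, ae_of_all _ fun _ => le_rfl⟩

lemma aestronglyMeasurable_flux {p : ℝ} {f g : E n → E n} {μ : Measure (E n)}
    (hf : AEStronglyMeasurable f μ) (hg : AEStronglyMeasurable g μ) :
    AEStronglyMeasurable (fun x => ‖f x‖ ^ (p - 2) * inner ℝ (f x) (g x)) μ :=
  (hf.norm.aemeasurable.pow_const _).aestronglyMeasurable.mul (hf.inner hg)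

/-- Replace the smaller norm by the larger one in ‖a‖^(p-1)‖b‖. This integrable majorant takes the
place of Hölder's inequality. -/
lemma abs_flux_le (a b : E n) :
    |‖a‖ ^ (p - 2) * inner ℝ a b| ≤ ‖a‖ ^ p + ‖b‖ ^ p := by
  have hp1 : 0 ≤ p - 1 := by linarith [hp.out]
  refine (abs_rpow_mul_inner_le p a b).trans ?_
  have e : ∀ x : ℝ, 0 ≤ x → x ^ (p - 1) * x = x ^ p := by
    intro x hx
    nth_rw 2 [← Real.rpow_one x]
    rw [← Real.rpow_add_of_nonneg hx hp1 zero_le_one, sub_add_cancel]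
  have h1 : 0 ≤ ‖a‖ ^ p := by positivity
  have h2 : 0 ≤ ‖b‖ ^ p := by positivity
  rcases le_total ‖a‖ ‖b‖ with h | h
  · calc ‖a‖ ^ (p - 1) * ‖b‖ ≤ ‖b‖ ^ (p - 1) * ‖b‖ := by gcongr
      _ ≤ _ := by rw [e _ (norm_nonneg b)]; linarith
  · calc ‖a‖ ^ (p - 1) * ‖b‖ ≤ ‖a‖ ^ (p - 1) * ‖a‖ := by gcongr
      _ ≤ _ := by rw [e _ (norm_nonneg a)]; linarith

lemma integrable_flux_of_memLp {f g : E n → E n} {μ : Measure (E n)}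
    (hf : MemLp f (ENNReal.ofReal p) μ) (hg : MemLp g (ENNReal.ofReal p) μ) :
    Integrable (fun x => ‖f x‖ ^ (p - 2) * inner ℝ (f x) (g x)) μ :=
  ((integrable_rpow_of_memLp hf).add (integrable_rpow_of_memLp hg)).mono'
    (aestronglyMeasurable_flux hf.1 hg.1) (ae_of_all _ fun _ => abs_flux_le _ _)

lemma integrable_flux (u v : W1p Ω p) :
    Integrable (fun x => ‖grad u x‖ ^ (p - 2) * inner ℝ (grad u x) (grad v x))
      (volume.restrict Ω) :=
  integrable_flux_of_memLp (memLp_grad u) (memLp_grad v)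

lemma fluxForm_self (S : Set (E n)) (σ : E n → ℝ) (u : W1p Ω p) :
    fluxForm S σ u u = ∫ x in S, σ x * ‖grad u x‖ ^ p := by
  simp only [fluxForm, rpow_mul_inner_self hp.out]

lemma norm_grad_le (u : W1p Ω p) : ‖u.1.2‖ ≤ ‖u‖ := le_max_right _ _

variable {σ : E n → ℝ}

lemma fluxForm_add (hσ : IsConductivity Ω σ) (u v w : W1p Ω p) :
    fluxForm Ω σ u (v + w) = fluxForm Ω σ u v + fluxForm Ω σ u w := by
  rw [fluxForm, fluxForm, fluxForm, ← integral_add (hσ.integrable_mul (integrable_flux u v))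
    (hσ.integrable_mul (integrable_flux u w))]
  refine integral_congr_ae ?_
  filter_upwards [grad_add v w] with x hx
  rw [hx, inner_add_right]; ring

lemma fluxForm_smul (u : W1p Ω p) (c : ℝ) (v : W1p Ω p) :
    fluxForm Ω σ u (c • v) = c * fluxForm Ω σ u v := by
  rw [fluxForm, fluxForm, ← integral_const_mul]
  refine integral_congr_ae ?_
  filter_upwards [grad_smul c v] with x hx
  rw [hx, real_inner_smul_right]; ring

lemma fluxForm_neg (u v : W1p Ω p) : fluxForm Ω σ u (-v) = -fluxForm Ω σ u v := by
  rw [fluxForm, fluxForm, ← integral_neg]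
  refine integral_congr_ae ?_
  filter_upwards [grad_neg v] with x hx
  rw [hx, inner_neg_right]; ring

/-- The flux form `v ↦ ∫_Ω σ |∇u|^{p-2} ∇u · ∇v dx` as a linear map. -/
def fluxLinear (hσ : IsConductivity Ω σ) (u : W1p Ω p) : W1p Ω p →ₗ[ℝ] ℝ where
  toFun v := fluxForm Ω σ u v
  map_add' := fluxForm_add hσ u
  map_smul' c v := fluxForm_smul u c v

lemma exists_abs_fluxForm_le (hσ : IsConductivity Ω σ) (u : W1p Ω p) :
    ∃ C : ℝ, ∀ v : W1p Ω p, ‖fluxLinear hσ u v‖ ≤ C * ‖v‖ := by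
  have hp0 : 0 < p := by linarith [hp.out]
  obtain ⟨M, hM⟩ : ∃ M : ℝ, ∀ᵐ x ∂(volume.restrict Ω), ‖σ x‖ ≤ M := by
    refine ⟨(eLpNormEssSup σ (volume.restrict Ω)).toReal, ?_⟩
    have hfin : eLpNormEssSup σ (volume.restrict Ω) ≠ ⊤ := by
      simpa using hσ.1.eLpNorm_ne_top
    filter_upwards [ae_le_eLpNormEssSup (f := σ) (μ := volume.restrict Ω)] with x hx
    simpa using ENNReal.toReal_mono hfin hx
  -- By linearity a bound on the unit ball is enough, and there ∫ |∇v|^p ≤ 1.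
  refine LinearMap.bound_of_ball_bound one_pos (|M| * ((∫ x in Ω, ‖grad u x‖ ^ p) + 1)) _ ?_
  intro v hv
  have hv1 : ‖v.1.2‖ ≤ 1 := (norm_grad_le v).trans (mem_ball_zero_iff.1 hv).le
  have h1 : ∫ x in Ω, ‖grad v x‖ ^ p ≤ 1 := by
    have := norm_rpow_Lp v.1.2
    rw [grad, ← this]
    exact Real.rpow_le_one (norm_nonneg _) hv1 hp0.le
  calc ‖fluxLinear hσ u v‖
      ≤ ∫ x in Ω, |M| * (‖grad u x‖ ^ p + ‖grad v x‖ ^ p) := by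
        refine norm_integral_le_of_norm_le
          (((integrable_rpow_grad u).add (integrable_rpow_grad v)).const_mul _) ?_
        filter_upwards [hM] with x hx
        rw [norm_mul]
        gcongr
        · exact hx.trans (le_abs_self M)
        · exact abs_flux_le _ _
    _ = |M| * ((∫ x in Ω, ‖grad u x‖ ^ p) + ∫ x in Ω, ‖grad v x‖ ^ p) := by
        rw [integral_const_mul, integral_add (integrable_rpow_grad u) (integrable_rpow_grad v)]
    _ ≤ _ := by gcongr

/-- The flux form `v ↦ ∫_Ω σ |∇u|^{p-2} ∇u · ∇v dx` as a bounded functional. -/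
def fluxCLM (hσ : IsConductivity Ω σ) (u : W1p Ω p) : W1p Ω p →L[ℝ] ℝ :=
  (fluxLinear hσ u).mkContinuousOfExistsBound (exists_abs_fluxForm_le hσ u)

/-- The energy lies above its tangents. -/
lemma energy_add_flux_le (hσ : IsConductivity Ω σ) (u v : W1p Ω p) :
    energy σ u + p * fluxForm Ω σ u (v - u) ≤ energy σ v := by
  rw [energy, energy, fluxForm, ← integral_const_mul, ← integral_add
    (hσ.integrable_mul (integrable_rpow_grad u))
    ((hσ.integrable_mul (integrable_flux u (v - u))).const_mul p)]
  refine integral_mono_ae ((hσ.integrable_mul (integrable_rpow_grad u)).add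
    ((hσ.integrable_mul (integrable_flux u (v - u))).const_mul p))
    (hσ.integrable_mul (integrable_rpow_grad v)) ?_
  filter_upwards [grad_sub v u, hσ.nonneg] with x hx h0
  have := mul_le_mul_of_nonneg_left (rpow_norm_add_le hp.out (grad u x) (grad v x)) h0
  rw [hx]
  linarith

/-- Dominated convergence with majorant |σ|(|∇u| + |∇w|)^p. Together with convexity, this continuity
makes differentiating the energy unnecessary. -/
lemma tendsto_fluxForm_add_smul (hσ : IsConductivity Ω σ) (u w : W1p Ω p) {t : ℕ → ℝ}
    (ht : Filter.Tendsto t Filter.atTop (nhds 0)) (ht1 : ∀ k, |t k| ≤ 1) :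
    Filter.Tendsto (fun k => fluxForm Ω σ (u + t k • w) w) Filter.atTop
      (nhds (fluxForm Ω σ u w)) := by
  have hp1 : 0 ≤ p - 1 := by linarith [hp.out]
  have hcongr : ∀ k, fluxForm Ω σ (u + t k • w) w = ∫ x in Ω, σ x *
      (‖grad u x + t k • grad w x‖ ^ (p - 2) *
        inner ℝ (grad u x + t k • grad w x) (grad w x)) := by
    intro k
    refine integral_congr_ae ?_
    filter_upwards [grad_add u (t k • w), grad_smul (t k) w] with x h1 h2
    rw [h1, h2]
  have hm : MemLp (fun x => ‖grad u x‖ + ‖grad w x‖) (ENNReal.ofReal p) (volume.restrict Ω) :=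
    (memLp_grad u).norm.add (memLp_grad w).norm
  simp only [hcongr]
  refine tendsto_integral_of_dominated_convergence
    (fun x => ‖σ x * ‖(‖grad u x‖ + ‖grad w x‖)‖ ^ p‖) ?_ ?_ ?_ ?_
  · intro k
    refine hσ.1.1.mul (aestronglyMeasurable_flux ?_ (memLp_grad w).1)
    exact (memLp_grad u).1.add ((memLp_grad w).1.const_smul (t k))
  · exact (hσ.integrable_mul (integrable_rpow_of_memLp hm)).norm
  · intro k
    refine ae_of_all _ fun x => ?_
    rw [norm_mul (σ x), norm_mul (σ x)]
    gcongr
    have h1 : ‖grad u x + t k • grad w x‖ ≤ ‖grad u x‖ + ‖grad w x‖ := by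
      refine (norm_add_le _ _).trans ?_
      gcongr
      rw [norm_smul]
      exact mul_le_of_le_one_left (norm_nonneg _) (ht1 k)
    have h0 : 0 ≤ ‖grad u x‖ + ‖grad w x‖ := by positivity
    rw [Real.norm_of_nonneg (by positivity : 0 ≤ ‖(‖grad u x‖ + ‖grad w x‖)‖ ^ p),
      Real.norm_of_nonneg h0]
    calc _ ≤ ‖grad u x + t k • grad w x‖ ^ (p - 1) * ‖grad w x‖ := abs_rpow_mul_inner_le p _ _
      _ ≤ (‖grad u x‖ + ‖grad w x‖) ^ (p - 1) * (‖grad u x‖ + ‖grad w x‖) := by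
        gcongr
        linarith [norm_nonneg (grad u x)]
      _ = _ := by
        nth_rw 2 [← Real.rpow_one (‖grad u x‖ + ‖grad w x‖)]
        rw [← Real.rpow_add_of_nonneg h0 hp1 zero_le_one, sub_add_cancel]
  · refine ae_of_all _ fun x => ?_
    refine Filter.Tendsto.const_mul _ ?_
    have hc : Continuous fun s : ℝ => grad u x + s • grad w x := by fun_prop
    have := ((continuous_rpow_mul_inner hp.out (grad w x)).comp hc).tendsto 0
    simp only [Function.comp_def, zero_smul, add_zero] at this
    exact this.comp ht

lemma trace_eq_trace_iff {u v : W1p Ω p} : trace u = trace v ↔ u - v ∈ W01p Ω p :=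
  Submodule.Quotient.eq _

/-- Take the tangent to the energy at the perturbed point v = u + s w rather than at u: E(v) - p
s·flux(v, w) ≤ E(u) ≤ E(v) gives flux(v, w) ≥ 0 for s > 0; then let s → 0. -/
lemma IsMinimizer.fluxForm_nonneg (hσ : IsConductivity Ω σ) {f : X Ω p} {u w : W1p Ω p}
    (hu : IsMinimizer σ f u) (hw : w ∈ W01p Ω p) : 0 ≤ fluxForm Ω σ u w := by
  have hp0 : 0 < p := by linarith [hp.out]
  refine ge_of_tendsto (tendsto_fluxForm_add_smul hσ u w tendsto_one_div_add_atTop_nhds_zero_nat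
    fun k => ?_) (Filter.Eventually.of_forall fun k => ?_)
  · have : (0 : ℝ) < k + 1 := by positivity
    rw [abs_of_nonneg (by positivity), div_le_one this]
    linarith [(Nat.cast_nonneg k : (0 : ℝ) ≤ k)]
  · set s : ℝ := 1 / ((k : ℝ) + 1)
    have hs : 0 < s := by positivity
    have hsw : s • w ∈ W01p Ω p := (W01p Ω p).smul_mem s hw
    obtain ⟨v, hv⟩ : ∃ v : W1p Ω p, v = u + s • w := ⟨_, rfl⟩
    have h1 : energy σ u ≤ energy σ v := by
      refine hu.2 _ (Eq.trans ?_ hu.1)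
      rwa [trace_eq_trace_iff, hv, add_sub_cancel_left]
    have h2 := energy_add_flux_le hσ v u
    have e : u - v = -(s • w) := by rw [hv, sub_add_cancel_left]
    rw [e, fluxForm_neg, fluxForm_smul v s w] at h2
    have h4 : 0 ≤ (p * s) * fluxForm Ω σ v w := by linarith
    rw [← hv]
    exact nonneg_of_mul_nonneg_right h4 (by positivity)

/-- The Euler-Lagrange equation. -/
lemma IsMinimizer.fluxForm_eq_zero (hσ : IsConductivity Ω σ) {f : X Ω p} {u w : W1p Ω p}
    (hu : IsMinimizer σ f u) (hw : w ∈ W01p Ω p) : fluxForm Ω σ u w = 0 := by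
  have h1 := hu.fluxForm_nonneg hσ hw
  have h2 := hu.fluxForm_nonneg hσ ((W01p Ω p).neg_mem hw)
  rw [fluxForm_neg] at h2
  linarith

/-- By convexity a critical point is a minimizer; this is how the explicit exponential solutions are
recognized. -/
lemma isMinimizer_of_fluxForm_eq_zero (hσ : IsConductivity Ω σ) {u : W1p Ω p}
    (hu : ∀ w ∈ W01p Ω p, fluxForm Ω σ u w = 0) : IsMinimizer σ (trace u) u := by
  refine ⟨rfl, fun v hv => ?_⟩
  have h := energy_add_flux_le hσ u v
  rwa [hu _ (trace_eq_trace_iff.1 hv), mul_zero, add_zero] at h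

/-- The Dirichlet-Neumann functional of a conductivity for which a minimizer exists. -/
lemma dnMap_trace (hσ : IsConductivity Ω σ) {f : X Ω p} (hf : ∃ u : W1p Ω p, IsMinimizer σ f u)
    (v : W1p Ω p) : dnMap Ω p σ f (trace v) = fluxForm Ω σ (solution σ f) v := by
  have hs : IsMinimizer σ f (solution σ f) := Classical.epsilon_spec hf
  have hex : ∃ ℓ : StrongDual ℝ (X Ω p),
      ∀ v : W1p Ω p, ℓ (trace v) = fluxForm Ω σ (solution σ f) v :=
    ⟨(W01p Ω p).liftQL (fluxCLM hσ (solution σ f)) fun w hw => hs.fluxForm_eq_zero hσ hw,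
      fun v => rfl⟩
  exact Classical.epsilon_spec hex v

/-- The minimizer is itself a representative of its boundary value, so it may be inserted in the
second slot. -/
lemma dnMap_self (hσ : IsConductivity Ω σ) {f : X Ω p} (hf : ∃ u : W1p Ω p, IsMinimizer σ f u) :
    dnMap Ω p σ f f = energy σ (solution σ f) := by
  have hs : IsMinimizer σ f (solution σ f) := Classical.epsilon_spec hf
  have h := dnMap_trace hσ hf (solution σ f)
  rw [hs.1, fluxForm_self] at h
  exact h

end Energy

/-! ### Weak gradients, completeness and the Poincaré inequality -/

section Sobolev

variable {n : ℕ} {Ω : Set (E n)} {p : ℝ}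

lemma IsTest.continuous_fderiv_apply {φ : E n → ℝ} (hφ : IsTest Ω φ) (v : E n) :
    Continuous fun x => fderiv ℝ φ x v :=
  (hφ.smooth.continuous_fderiv (by simp)).clm_apply continuous_const

/-- Integration by parts against a test function. -/
lemma IsTest.integral_mul_fderiv {φ h : E n → ℝ} (hφ : IsTest Ω φ) (hh : ContDiff ℝ 1 h)
    (v : E n) : ∫ x in Ω, h x * fderiv ℝ φ x v = -∫ x in Ω, φ x * fderiv ℝ h x v := by
  have hout : ∀ x, x ∉ Ω → x ∉ tsupport φ := fun x hx h => hx (hφ.subset h)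
  have hc : Continuous fun x => fderiv ℝ h x v :=
    (hh.continuous_fderiv one_ne_zero).clm_apply continuous_const
  rw [setIntegral_eq_integral_of_forall_compl_eq_zero, setIntegral_eq_integral_of_forall_compl_eq_zero]
  · rw [integral_mul_fderiv_eq_neg_fderiv_mul_of_integrable]
    · simp only [mul_comm]
    · exact (hc.mul hφ.smooth.continuous).integrable_of_hasCompactSupport hφ.compact.mul_left
    · exact (hh.continuous.mul (hφ.continuous_fderiv_apply v)).integrable_of_hasCompactSupport
        (hφ.compact.fderiv_apply ℝ v).mul_left
    · exact (hh.continuous.mul hφ.smooth.continuous).integrable_of_hasCompactSupport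
        hφ.compact.mul_left
    · exact fun x _ => hh.differentiable one_ne_zero x
    · exact fun x _ => hφ.smooth.differentiable (by simp) x
  · intro x hx
    rw [image_eq_zero_of_notMem_tsupport (hout x hx), zero_mul]
  · intro x hx
    rw [image_eq_zero_of_notMem_tsupport (f := fderiv ℝ φ)
      fun h => hout x hx (tsupport_fderiv_subset ℝ h)]
    simp

lemma inner_gradient (h : E n → ℝ) (x v : E n) : inner ℝ (gradient h x) v = fderiv ℝ h x v := by
  rw [← toDual_gradient, InnerProductSpace.toDual_apply_apply]

lemma norm_gradient (h : E n → ℝ) (x : E n) : ‖gradient h x‖ = ‖fderiv ℝ h x‖ := by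
  rw [← toDual_gradient, LinearIsometryEquiv.norm_map]

lemma continuous_gradient {h : E n → ℝ} (hh : ContDiff ℝ 1 h) : Continuous (gradient h) :=
  (LinearIsometryEquiv.continuous _).comp (hh.continuous_fderiv one_ne_zero)

lemma isWeakGradient_gradient {h : E n → ℝ} (hh : ContDiff ℝ 1 h) :
    IsWeakGradient Ω h (gradient h) := by
  intro φ hφ v
  simp only [inner_gradient]
  exact hφ.integral_mul_fderiv hh v

lemma IsWeakGradient.congr {u u' : E n → ℝ} {G G' : E n → E n} (h : IsWeakGradient Ω u G)
    (hu : u =ᵐ[volume.restrict Ω] u') (hG : G =ᵐ[volume.restrict Ω] G') :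
    IsWeakGradient Ω u' G' := by
  intro φ hφ v
  have h1 : ∫ x in Ω, u x * fderiv ℝ φ x v = ∫ x in Ω, u' x * fderiv ℝ φ x v :=
    integral_congr_ae (by filter_upwards [hu] with x hx; rw [hx])
  have h2 : ∫ x in Ω, φ x * inner ℝ (G x) v = ∫ x in Ω, φ x * inner ℝ (G' x) v :=
    integral_congr_ae (by filter_upwards [hG] with x hx; rw [hx])
  rw [← h1, ← h2]
  exact h φ hφ v

/-- The fundamental lemma of the calculus of variations, applied to each coordinate of the
difference. -/
lemma IsWeakGradient.unique (hΩ : IsOpen Ω) {u : E n → ℝ} {G G' : E n → E n}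
    (hG : LocallyIntegrable G (volume.restrict Ω)) (hG' : LocallyIntegrable G' (volume.restrict Ω))
    (h : IsWeakGradient Ω u G) (h' : IsWeakGradient Ω u G') : G =ᵐ[volume.restrict Ω] G' := by
  have key : ∀ v : E n, ∀ᵐ x ∂(volume.restrict Ω), inner ℝ (G x - G' x) v = (0 : ℝ) := by
    intro v
    have hD : LocallyIntegrable (fun x => inner ℝ (G x - G' x) v) (volume.restrict Ω) := by
      intro x
      obtain ⟨U, hU, hi⟩ := (hG.sub hG') x
      exact ⟨U, hU, Integrable.inner_const (𝕜 := ℝ) hi v⟩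
    rw [ae_restrict_iff' hΩ.measurableSet]
    refine hΩ.ae_eq_zero_of_integral_contDiff_smul_eq_zero
      (locallyIntegrableOn_of_locallyIntegrable_restrict hD) fun φ h1 h2 h3 => ?_
    have hφ : IsTest Ω φ := ⟨h1, h2, h3⟩
    rw [← setIntegral_eq_integral_of_forall_compl_eq_zero (s := Ω) fun x hx => by
      rw [image_eq_zero_of_notMem_tsupport fun h => hx (h3 h), zero_smul]]
    simp only [inner_sub_left, smul_eq_mul, mul_sub]
    rw [integral_sub (hφ.integrable_mul hG v) (hφ.integrable_mul hG' v), sub_eq_zero,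
      ← neg_inj, ← h φ hφ v, ← h' φ hφ v]
  have := ae_all_iff.2 fun i : Fin n => key (EuclideanSpace.single i 1)
  filter_upwards [this] with x hx
  rw [← sub_eq_zero]
  ext i
  simpa [EuclideanSpace.inner_single_right] using hx i

variable [hp : Fact (1 < p)]

lemma grad_ae_eq_gradient (hΩ : IsOpen Ω) {w : W1p Ω p} {h : E n → ℝ} (hh : ContDiff ℝ 1 h)
    (hw : w.1.1 =ᵐ[volume.restrict Ω] h) : grad w =ᵐ[volume.restrict Ω] gradient h := by
  refine IsWeakGradient.unique hΩ ((memLp_grad w).locallyIntegrable Fact.out)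
    ((continuous_gradient hh).locallyIntegrable) (u := h) ?_ (isWeakGradient_gradient hh)
  exact IsWeakGradient.congr w.2 hw Filter.EventuallyEq.rfl

/-- The element of `W^{1,p}(Ω)` given by a continuously differentiable function on `ℝⁿ`. -/
lemma exists_W1p_of_contDiff (hΩ : IsOpen Ω) (hΩb : Bornology.IsBounded Ω) {h : E n → ℝ}
    (hh : ContDiff ℝ 1 h) :
    ∃ w : W1p Ω p, grad w =ᵐ[volume.restrict Ω] gradient h := by
  have hfin : IsFiniteMeasure (volume.restrict Ω) :=
    ⟨by simpa using hΩb.measure_lt_top⟩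
  have hm : ∀ {F : Type} [NormedAddCommGroup F] {f : E n → F}, Continuous f →
      MemLp f (ENNReal.ofReal p) (volume.restrict Ω) := by
    intro F _ f hf
    obtain ⟨C, hC⟩ := hΩb.isCompact_closure.exists_bound_of_continuousOn hf.continuousOn
    refine MemLp.of_bound hf.aestronglyMeasurable C ?_
    filter_upwards [ae_restrict_mem hΩ.measurableSet] with x hx using hC x (subset_closure hx)
  have hg := continuous_gradient hh
  refine ⟨⟨((hm hh.continuous).toLp h, (hm hg).toLp (gradient h)), ?_⟩, MemLp.coeFn_toLp (hm hg)⟩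
  exact (isWeakGradient_gradient hh).congr (hm hh.continuous).coeFn_toLp.symm
    (hm hg).coeFn_toLp.symm

/-- For a fixed test function both sides of the weak gradient identity are pairings with fixed
elements of the dual exponent's L^q, hence continuous. -/
lemma isClosed_W1p : IsClosed (W1p Ω p : Set (Lp ℝ (ENNReal.ofReal p) (volume.restrict Ω) ×
    Lp (E n) (ENNReal.ofReal p) (volume.restrict Ω))) := by
  have hpq := ENNReal.HolderConjugate.conjExponent
    (Fact.out : 1 ≤ ENNReal.ofReal p)
  set q := ENNReal.conjExponent (ENNReal.ofReal p)
  have hq : Fact (1 ≤ q) := ⟨hpq.symm.one_le⟩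
  have hset : (W1p Ω p : Set (Lp ℝ (ENNReal.ofReal p) (volume.restrict Ω) ×
      Lp (E n) (ENNReal.ofReal p) (volume.restrict Ω))) =
      ⋂ (φ : E n → ℝ) (_ : IsTest Ω φ) (v : E n), {w | ∫ x in Ω, w.1 x * fderiv ℝ φ x v =
        - ∫ x in Ω, φ x * inner ℝ (w.2 x) v} := by
    ext w
    simp only [mem_iInter]
    rfl
  rw [hset]
  refine isClosed_iInter fun φ => isClosed_iInter fun hφ => isClosed_iInter fun v => ?_
  have m1 : MemLp (fun x => fderiv ℝ φ x v) q (volume.restrict Ω) :=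
    (hφ.continuous_fderiv_apply v).memLp_of_hasCompactSupport (hφ.compact.fderiv_apply ℝ v)
  have m2 : MemLp (fun x => φ x • v) q (volume.restrict Ω) :=
    (hφ.smooth.continuous.smul continuous_const).memLp_of_hasCompactSupport hφ.compact.smul_right
  have e1 : ∀ f : Lp ℝ (ENNReal.ofReal p) (volume.restrict Ω),
      ∫ x in Ω, f x * fderiv ℝ φ x v =
      (ContinuousLinearMap.mul ℝ ℝ).lpPairing (volume.restrict Ω) (ENNReal.ofReal p) q f
        (m1.toLp _) := by
    intro f
    rw [ContinuousLinearMap.lpPairing_eq_integral]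
    refine integral_congr_ae ?_
    filter_upwards [m1.coeFn_toLp] with x hx
    rw [hx, ContinuousLinearMap.mul_apply']
  have e2 : ∀ f : Lp (E n) (ENNReal.ofReal p) (volume.restrict Ω),
      ∫ x in Ω, φ x * inner ℝ (f x) v =
      (innerSL ℝ).lpPairing (volume.restrict Ω) (ENNReal.ofReal p) q f (m2.toLp _) := by
    intro f
    rw [ContinuousLinearMap.lpPairing_eq_integral]
    refine integral_congr_ae ?_
    filter_upwards [m2.coeFn_toLp] with x hx
    rw [hx, innerSL_apply_apply, real_inner_smul_right]
  simp only [e1, e2]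
  refine isClosed_eq ?_ ?_
  · exact (((ContinuousLinearMap.mul ℝ ℝ).lpPairing (volume.restrict Ω) (ENNReal.ofReal p)
      q).flip (m1.toLp _)).continuous.comp continuous_fst
  · have hc : Continuous fun f : Lp (E n) (ENNReal.ofReal p) (volume.restrict Ω) =>
        (innerSL ℝ).lpPairing (volume.restrict Ω) (ENNReal.ofReal p) q f (m2.toLp _) :=
      (((innerSL ℝ).lpPairing (volume.restrict Ω) (ENNReal.ofReal p) q).flip
        (m2.toLp _)).continuous
    exact (hc.comp continuous_snd).neg

instance completeSpace_W1p : CompleteSpace (W1p Ω p) :=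
  isClosed_W1p.completeSpace_coe

/-- The Poincaré inequality for test functions. -/
lemma exists_eLpNorm_le_fderiv (hn : 2 ≤ n) (hΩb : Bornology.IsBounded Ω) :
    ∃ C : NNReal, ∀ φ : E n → ℝ, IsTest Ω φ →
      eLpNorm φ (ENNReal.ofReal p) (volume.restrict Ω) ≤
        C * eLpNorm (fderiv ℝ φ) (ENNReal.ofReal p) (volume.restrict Ω) := by
  have hp1 : 1 < p := hp.out
  have hn' : (2 : ℝ) ≤ n := by exact_mod_cast hn
  -- The Sobolev conjugate of np/(n+p) is p, and the maximum with 1 keeps the exponent admissible.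
  -- Since n ≥ 2, `r < n`; since `r ≤ p`, Hölder's inequality on the bounded set returns from `r` to
  -- `p` at the cost of `K`.
  set r : ℝ := max 1 (n * p / (n + p)) with hr
  have hr1 : 1 ≤ r := le_max_left _ _
  have hrn : r < n := by
    refine max_lt (by linarith) ?_
    rw [div_lt_iff₀ (by positivity)]
    nlinarith
  have hrp : r ≤ p := by
    refine max_le hp1.le ?_
    rw [div_le_iff₀ (by positivity)]
    nlinarith
  have hrinv : r⁻¹ - (n : ℝ)⁻¹ ≤ p⁻¹ := by
    have h1 : r⁻¹ ≤ (n * p / (n + p))⁻¹ := inv_anti₀ (by positivity) (le_max_right _ _)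
    have h2 : (n * p / (n + p))⁻¹ = p⁻¹ + (n : ℝ)⁻¹ := by
      have : p ≠ 0 := by positivity
      field_simp
    linarith
  have hfin : IsFiniteMeasure (volume.restrict Ω) := ⟨by simpa using hΩb.measure_lt_top⟩
  set K : ℝ≥0∞ := (volume.restrict Ω) univ ^ (1 / (ENNReal.ofReal r).toReal -
    1 / (ENNReal.ofReal p).toReal) with hK
  have hKfin : K ≠ ⊤ := by
    refine ENNReal.rpow_ne_top_of_nonneg ?_ (measure_ne_top _ _)
    rw [ENNReal.toReal_ofReal (by linarith), ENNReal.toReal_ofReal (by linarith), sub_nonneg]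
    gcongr
  set C₀ := eLpNormLESNormFDerivOfLeConst ℝ (volume : Measure (E n)) Ω r.toNNReal p.toNNReal
  refine ⟨C₀ * K.toNNReal, fun φ hφ => ?_⟩
  have hsupp : Function.support φ ⊆ Ω := (subset_tsupport φ).trans hφ.subset
  have hsupp' : Function.support (fderiv ℝ φ) ⊆ Ω :=
    (support_fderiv_subset ℝ).trans hφ.subset
  have h1 : eLpNorm φ (ENNReal.ofReal p) volume ≤
      C₀ * eLpNorm (fderiv ℝ φ) (ENNReal.ofReal r) volume := by
    refine eLpNorm_le_eLpNorm_fderiv_of_le (volume : Measure (E n)) (p := r.toNNReal)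
      (q := p.toNNReal) (hφ.smooth.of_le (by simp)) hsupp ?_ ?_ ?_ hΩb
    · exact Real.one_le_toNNReal.2 hr1
    · rw [finrank_euclideanSpace_fin]
      exact Real.toNNReal_lt_natCast'.2 ⟨hrn, by omega⟩
    · rw [finrank_euclideanSpace_fin, Real.coe_toNNReal _ (by linarith), NNReal.coe_inv,
        Real.coe_toNNReal _ (by linarith)]
      exact hrinv
  rw [eLpNorm_restrict_eq_of_support_subset hsupp]
  refine h1.trans ?_
  have h3 : eLpNorm (fderiv ℝ φ) (ENNReal.ofReal r) (volume.restrict Ω) =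
      eLpNorm (fderiv ℝ φ) (ENNReal.ofReal r) volume :=
    eLpNorm_restrict_eq_of_support_subset (ε := E n →L[ℝ] ℝ) (by exact hsupp')
  rw [← h3]
  have h2 : eLpNorm (fderiv ℝ φ) (ENNReal.ofReal r) (volume.restrict Ω) ≤
      eLpNorm (fderiv ℝ φ) (ENNReal.ofReal p) (volume.restrict Ω) * K :=
    eLpNorm_le_eLpNorm_mul_rpow_measure_univ (ENNReal.ofReal_le_ofReal hrp)
      (hφ.smooth.continuous_fderiv (by simp)).aestronglyMeasurable
  calc _ ≤ (C₀ : ℝ≥0∞) *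
      (eLpNorm (fderiv ℝ φ) (ENNReal.ofReal p) (volume.restrict Ω) * K) := by gcongr
    _ = _ := by rw [ENNReal.coe_mul, ENNReal.coe_toNNReal hKfin]; ring

/-- The Poincaré inequality on `W₀^{1,p}(Ω)`. -/
lemma exists_norm_le_norm_grad (hn : 2 ≤ n) (hΩ : IsOpen Ω) (hΩb : Bornology.IsBounded Ω) :
    ∃ C : ℝ, ∀ w ∈ W01p Ω p, ‖w‖ ≤ C * ‖w.1.2‖ := by
  obtain ⟨C, hC⟩ := exists_eLpNorm_le_fderiv (p := p) hn hΩb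
  refine ⟨max C 1, fun w hw => ?_⟩
  have hclosed : IsClosed {w : W1p Ω p | ‖w‖ ≤ max (C : ℝ) 1 * ‖w.1.2‖} :=
    isClosed_le continuous_norm
      (continuous_const.mul (continuous_snd.comp continuous_subtype_val).norm)
  refine closure_minimal (s := (testSubmodule Ω p : Set (W1p Ω p))) ?_ hclosed hw
  rintro w ⟨φ, hφ, hwφ⟩
  have hgrad := grad_ae_eq_gradient hΩ (hφ.smooth.of_le (by simp)) hwφ
  have h1 : ‖w.1.1‖ ≤ C * ‖w.1.2‖ := by
    have h2 : eLpNorm (w.1.2) (ENNReal.ofReal p) (volume.restrict Ω) =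
        eLpNorm (fderiv ℝ φ) (ENNReal.ofReal p) (volume.restrict Ω) := by
      refine eLpNorm_congr_norm_ae ?_
      filter_upwards [hgrad] with x hx
      rw [← norm_gradient, ← hx, grad]
    rw [Lp.norm_def, Lp.norm_def, eLpNorm_congr_ae hwφ, h2, ← ENNReal.coe_toReal,
      ← ENNReal.toReal_mul]
    refine ENNReal.toReal_mono (ENNReal.mul_ne_top ENNReal.coe_ne_top ?_) (hC φ hφ)
    rw [← h2]
    exact Lp.eLpNorm_ne_top _
  change max ‖w.1.1‖ ‖w.1.2‖ ≤ _
  refine max_le (h1.trans ?_) ?_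
  · gcongr; exact le_max_left _ _
  · exact le_mul_of_one_le_left (norm_nonneg _) (le_max_right _ _)

end Sobolev

/-! ### Existence of minimizers by uniform convexity -/

section Dirichlet

variable {n : ℕ} {Ω : Set (E n)} {p : ℝ} [hp : Fact (1 < p)] {σ : E n → ℝ}

lemma energy_nonneg (hσ : IsConductivity Ω σ) (u : W1p Ω p) : 0 ≤ energy σ u := by
  refine integral_nonneg_of_ae ?_
  filter_upwards [hσ.nonneg] with x hx
  exact mul_nonneg hx (by positivity)

/-- Uniform convexity of the energy. -/
lemma exists_energy_sub_le (hσ : IsConductivity Ω σ) {ε : ℝ} (hε : 0 < ε) :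
    ∃ C : ℝ, 0 ≤ C ∧ ∀ u v : W1p Ω p, energy σ (u - v) ≤ ε * (energy σ u + energy σ v) +
      C * ((energy σ u + energy σ v) / 2 - energy σ ((1 / 2 : ℝ) • (u + v))) := by
  obtain ⟨C, hC, h⟩ := exists_rpow_norm_sub_le (V := E n) hp.out hε
  refine ⟨C, hC, fun u v => ?_⟩
  obtain ⟨m, hm⟩ : ∃ m : W1p Ω p, m = (1 / 2 : ℝ) • (u + v) := ⟨_, rfl⟩
  have hgm : ∀ᵐ x ∂(volume.restrict Ω), grad m x = (1 / 2 : ℝ) • (grad u x + grad v x) := by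
    filter_upwards [grad_smul (1 / 2) (u + v), grad_add u v] with x h1 h2
    rw [hm, h1, h2]
  rw [← hm]
  have iu := hσ.integrable_mul (integrable_rpow_grad u)
  have iv := hσ.integrable_mul (integrable_rpow_grad v)
  have im := hσ.integrable_mul (integrable_rpow_grad m)
  have i1 : Integrable (fun x => (ε + C / 2) * (σ x * ‖grad u x‖ ^ p) +
      (ε + C / 2) * (σ x * ‖grad v x‖ ^ p)) (volume.restrict Ω) :=
    (iu.const_mul _).add (iv.const_mul _)
  have i2 := im.const_mul C
  have e : ε * (energy σ u + energy σ v) + C * ((energy σ u + energy σ v) / 2 - energy σ m) =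
      ∫ x in Ω, ((ε + C / 2) * (σ x * ‖grad u x‖ ^ p) +
      (ε + C / 2) * (σ x * ‖grad v x‖ ^ p) - C * (σ x * ‖grad m x‖ ^ p)) := by
    rw [integral_sub i1 i2, integral_add (iu.const_mul _) (iv.const_mul _), integral_const_mul,
      integral_const_mul, integral_const_mul, energy, energy, energy]
    ring
  rw [e]
  refine integral_mono_ae (hσ.integrable_mul (integrable_rpow_grad (u - v))) (i1.sub i2) ?_
  filter_upwards [grad_sub u v, hgm, hσ.nonneg] with x h1 h2 h3
  have := mul_le_mul_of_nonneg_left (h (grad u x) (grad v x)) h3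
  rw [h1, h2]
  linarith

/-- Coercivity: the Poincaré inequality combined with the positive lower bound of σ. -/
lemma exists_norm_rpow_le_energy (hn : 2 ≤ n) (hΩ : IsOpen Ω) (hΩb : Bornology.IsBounded Ω)
    (hσ : IsConductivity Ω σ) :
    ∃ C : ℝ, 0 < C ∧ ∀ w ∈ W01p Ω p, ‖w‖ ^ p ≤ C * energy σ w := by
  obtain ⟨c, hc, hσc⟩ := hσ.2
  obtain ⟨C, hC⟩ := exists_norm_le_norm_grad (p := p) hn hΩ hΩb
  have hp0 : 0 ≤ p := by linarith [hp.out]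
  have hC' : 0 < max C 1 := lt_max_of_lt_right one_pos
  refine ⟨(max C 1) ^ p / c, by positivity, fun w hw => ?_⟩
  have h1 : ‖w‖ ≤ max C 1 * ‖w.1.2‖ :=
    (hC w hw).trans (by gcongr; exact le_max_left _ _)
  have h2 : c * ‖w.1.2‖ ^ p ≤ energy σ w := by
    rw [norm_rpow_Lp, ← integral_const_mul]
    refine integral_mono_ae ((integrable_rpow_grad w).const_mul c)
      (hσ.integrable_mul (integrable_rpow_grad w)) ?_
    filter_upwards [hσc] with x hx
    exact mul_le_mul_of_nonneg_right hx (by positivity)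
  calc ‖w‖ ^ p ≤ (max C 1 * ‖w.1.2‖) ^ p := by gcongr
    _ = (max C 1) ^ p / c * (c * ‖w.1.2‖ ^ p) := by
      rw [Real.mul_rpow hC'.le (norm_nonneg _)]; field_simp
    _ ≤ _ := by gcongr

lemma trace_midpoint {u v : W1p Ω p} (h : trace u = trace v) :
    trace ((1 / 2 : ℝ) • (u + v)) = trace v := by
  obtain ⟨d, hd⟩ : ∃ d : W1p Ω p, d = u - v := ⟨_, rfl⟩
  have hd' : d ∈ W01p Ω p := by rw [hd]; exact trace_eq_trace_iff.1 h
  obtain rfl : u = d + v := by rw [hd, sub_add_cancel]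
  have h1 : (1 / 2 : ℝ) • (d + v + v) - v = (1 / 2 : ℝ) • d := by
    module
  rw [trace_eq_trace_iff, h1]
  exact (W01p Ω p).smul_mem _ hd'

lemma tendsto_fluxForm_sub (hσ : IsConductivity Ω σ) {u : ℕ → W1p Ω p} {v : W1p Ω p}
    (hv : Filter.Tendsto u Filter.atTop (nhds v)) :
    Filter.Tendsto (fun k => fluxForm Ω σ v (u k - v)) Filter.atTop (nhds 0) := by
  obtain ⟨C, hC⟩ := exists_abs_fluxForm_le hσ v
  have h := (tendsto_iff_norm_sub_tendsto_zero.1 hv).const_mul C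
  rw [mul_zero] at h
  exact squeeze_zero_norm (fun k => hC (u k - v)) h

/-- The arithmetic of the Cauchy estimate. Here `m` is the infimum, and `e₀`, `e₁`, `e₂`, `e₃` are
the energies of the difference, of the midpoint and of two near-minimizers. The choice of `δ` lets
the first term contribute at most ε^p/2, and the bound on `η` keeps the second below ε^p/2. -/
lemma lt_of_rpow_le_of_near_min {p K C m d ε δ η e₀ e₁ e₂ e₃ : ℝ} (hp0 : 0 < p) (hK : 0 < K)
    (hC : 0 ≤ C) (hm0 : 0 ≤ m) (hd : 0 ≤ d) (hε : 0 < ε)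
    (hδ : δ = ε ^ p / (2 * (K * (2 * m + 2))))
    (h1 : e₀ ≤ δ * (e₂ + e₃) + C * ((e₂ + e₃) / 2 - e₁)) (h2 : d ^ p ≤ K * e₀) (hmid : m ≤ e₁)
    (h3 : e₂ < m + η) (h4 : e₃ < m + η) (hη : η < ε ^ p / (2 * (K * (C + 1)))) (hη1 : η ≤ 1)
    (hη0 : 0 < η) : d < ε := by
  rw [lt_div_iff₀ (by positivity)] at hη
  have hδ0 : 0 < δ := by rw [hδ]; positivity
  have h7 : C * ((e₂ + e₃) / 2 - e₁) ≤ C * η := by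
    gcongr; linarith
  have h8 : δ * (e₂ + e₃) ≤ δ * (2 * m + 2) :=
    mul_le_mul_of_nonneg_left (by linarith) hδ0.le
  have h9 : K * (δ * (2 * m + 2)) = ε ^ p / 2 := by
    rw [hδ]; field_simp
  have h10 : K * e₀ ≤ K * (δ * (2 * m + 2) + C * η) := by
    gcongr; linarith
  have h11 : 0 < K * η := by positivity
  refine (Real.rpow_lt_rpow_iff hd hε.le hp0).1 ?_
  nlinarith

/-- The Dirichlet problem has a solution. -/
lemma exists_isMinimizer (hn : 2 ≤ n) (hΩ : IsOpen Ω) (hΩb : Bornology.IsBounded Ω)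
    (hσ : IsConductivity Ω σ) (f : X Ω p) : ∃ u : W1p Ω p, IsMinimizer σ f u := by
  have hp0 : 0 < p := by linarith [hp.out]
  set A : Set (W1p Ω p) := {w | trace w = f} with hA
  obtain ⟨w₀, hw₀⟩ : ∃ w : W1p Ω p, trace w = f := Submodule.mkQ_surjective _ f
  have hbdd : BddBelow (energy σ '' A) := ⟨0, by rintro _ ⟨w, _, rfl⟩; exact energy_nonneg hσ w⟩
  set m := sInf (energy σ '' A) with hm
  have hm0 : 0 ≤ m := le_csInf ⟨_, w₀, hw₀, rfl⟩ (by rintro _ ⟨w, _, rfl⟩; exact energy_nonneg hσ w)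
  have hmle : ∀ w : W1p Ω p, trace w = f → m ≤ energy σ w := fun w hw =>
    csInf_le hbdd ⟨w, hw, rfl⟩
  have hseq : ∀ k : ℕ, ∃ u : W1p Ω p, trace u = f ∧ energy σ u < m + 1 / ((k : ℝ) + 1) := by
    intro k
    obtain ⟨_, ⟨u, hu, rfl⟩, h⟩ := exists_lt_of_csInf_lt (⟨_, w₀, hw₀, rfl⟩ : (energy σ '' A).Nonempty)
      (show sInf (energy σ '' A) < m + 1 / ((k : ℝ) + 1) from lt_add_of_pos_right _ (by positivity))
    exact ⟨u, hu, h⟩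
  choose u hut hue using hseq
  obtain ⟨K, hK, hKw⟩ := exists_norm_rpow_le_energy (p := p) hn hΩ hΩb hσ
  have hone : ∀ k : ℕ, 1 / ((k : ℝ) + 1) ≤ 1 := by
    intro k
    rw [div_le_one (by positivity)]
    linarith [(Nat.cast_nonneg k : (0 : ℝ) ≤ k)]
  have hcauchy : CauchySeq u := by
    rw [Metric.cauchySeq_iff']
    intro ε hε
    set δ := ε ^ p / (2 * (K * (2 * m + 2))) with hδ
    have hδ0 : 0 < δ := by positivity
    obtain ⟨C, hC, hCu⟩ := exists_energy_sub_le (Ω := Ω) (p := p) hσ hδ0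
    obtain ⟨N, hN⟩ := exists_nat_one_div_lt (show 0 < ε ^ p / (2 * (K * (C + 1))) by positivity)
    refine ⟨N, fun k hk => ?_⟩
    have hkN : 1 / ((k : ℝ) + 1) ≤ 1 / ((N : ℝ) + 1) := by gcongr
    have hw : u k - u N ∈ W01p Ω p := trace_eq_trace_iff.1 ((hut k).trans (hut N).symm)
    have hmid := hmle _ ((trace_midpoint ((hut k).trans (hut N).symm)).trans (hut N))
    have h1 := hCu (u k) (u N)
    have h2 := hKw _ hw
    have h3 := hue k
    have h4 := hue N
    rw [dist_eq_norm]
    exact lt_of_rpow_le_of_near_min hp0 hK hC hm0 (norm_nonneg _) hε hδ h1 h2 hmid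
      (h3.trans_le (by gcongr)) h4 hN (hone N) (by positivity)
  obtain ⟨v, hv⟩ := cauchySeq_tendsto_of_complete hcauchy
  have hvt : trace v = f := by
    rw [← hut 0, trace_eq_trace_iff]
    have hcl : IsClosed (W01p Ω p : Set (W1p Ω p)) :=
      Submodule.isClosed_topologicalClosure _
    refine hcl.mem_of_tendsto (hv.sub_const (u 0)) (Filter.Eventually.of_forall fun k => ?_)
    exact trace_eq_trace_iff.1 ((hut k).trans (hut 0).symm)
  refine ⟨v, hvt, fun w hw => le_trans ?_ (hmle w hw)⟩
  -- Lower semicontinuity through tangents: E(v) + p·flux(v, u_k - v) ≤ E(u_k), and the flux term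
  -- tends to 0.
  have hflux : Filter.Tendsto (fun k => energy σ v + p * fluxForm Ω σ v (u k - v))
      Filter.atTop
      (nhds (energy σ v)) := by
    have h3 := ((tendsto_fluxForm_sub hσ hv).const_mul p).const_add (energy σ v)
    rw [mul_zero, add_zero] at h3
    exact h3
  have hlim : Filter.Tendsto (fun k : ℕ => m + 1 / ((k : ℝ) + 1)) Filter.atTop (nhds m) := by
    simpa using tendsto_one_div_add_atTop_nhds_zero_nat.const_add m
  exact le_of_tendsto_of_tendsto' hflux hlim fun k =>
    (energy_add_flux_le hσ v (u k)).trans (hue k).le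

end Dirichlet

/-! ### Exponential solutions of the p-Laplace equation -/

section Exponential

variable {p : ℝ}

lemma one_add_mul_sin_sq_pos (hp : 1 < p) (y : ℝ) : 0 < 1 + (p - 2) * Real.sin y ^ 2 := by
  have h : 1 + (p - 2) * Real.sin y ^ 2 = Real.cos y ^ 2 + (p - 1) * Real.sin y ^ 2 := by
    rw [Real.cos_sq']; ring
  have hp1 : 0 < p - 1 := by linarith
  rw [h]
  by_cases hs : Real.sin y = 0
  · rw [Real.cos_sq', hs]; norm_num
  · have : 0 < Real.sin y ^ 2 := by positivity
    positivity

/-- The angle of the gradient of the exponential solutions: the inverse function of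
`θ ↦ (pθ/2 - (p-2) sin(2θ)/4) / (p-1)`. -/
lemma exists_angle (hp : 1 < p) :
    ∃ θ : ℝ → ℝ, ∀ t, HasDerivAt θ ((p - 1) / (1 + (p - 2) * Real.sin (θ t) ^ 2)) t := by
  have hp1 : 0 < p - 1 := by linarith
  -- An antiderivative of (1 + (p-2) sin² y)/(p-1), the reciprocal of the prescribed slope. It stays
  -- within bounded distance of a linear function of positive slope, so it is onto and its inverse
  -- is defined for all times.
  set S : ℝ → ℝ := fun y => (p / 2 * y - (p - 2) / 4 * Real.sin (2 * y)) / (p - 1) with hS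
  have hpos := one_add_mul_sin_sq_pos hp
  have hder : ∀ y, HasDerivAt S ((1 + (p - 2) * Real.sin y ^ 2) / (p - 1)) y := by
    intro y
    have h1 : HasDerivAt (fun y : ℝ => Real.sin (2 * y)) (Real.cos (2 * y) * 2) y := by
      simpa using ((hasDerivAt_id y).const_mul 2).sin
    have h2 := (((hasDerivAt_id y).const_mul (p / 2)).sub (h1.const_mul ((p - 2) / 4))).div_const
      (p - 1)
    refine h2.congr_deriv ?_
    rw [Real.cos_two_mul, Real.cos_sq']
    ring
  have hcont : Continuous S := continuous_iff_continuousAt.2 fun y => (hder y).continuousAt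
  have hmono : StrictMono S := by
    refine strictMono_of_deriv_pos fun y => ?_
    rw [(hder y).deriv]
    exact div_pos (hpos y) hp1
  have hp2 : 0 < p / 2 / (p - 1) := by positivity
  have hbd : ∀ y, |S y - p / 2 / (p - 1) * y| ≤ |p - 2| / 4 / (p - 1) := by
    intro y
    have : S y - p / 2 / (p - 1) * y = -((p - 2) / 4 / (p - 1) * Real.sin (2 * y)) := by
      simp only [hS]; field_simp; ring
    rw [this, abs_neg, abs_mul, abs_div, abs_div, abs_of_pos hp1, abs_of_pos (four_pos (α := ℝ))]
    exact mul_le_of_le_one_right (by positivity) (Real.abs_sin_le_one _)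
  have hsurj : Function.Surjective S := by
    refine hcont.surjective ?_ ?_
    · refine Filter.tendsto_atTop_mono (f := fun y => p / 2 / (p - 1) * y - |p - 2| / 4 / (p - 1))
        (fun y => ?_) ?_
      · linarith [(abs_le.1 (hbd y)).1]
      · exact Filter.tendsto_atTop_add_const_right _ _ (Filter.tendsto_id.const_mul_atTop hp2)
    · refine Filter.tendsto_atBot_mono (f := fun y => p / 2 / (p - 1) * y + |p - 2| / 4 / (p - 1))
        (fun y => ?_) ?_
      · linarith [(abs_le.1 (hbd y)).2]
      · exact Filter.tendsto_atBot_add_const_right _ _ (Filter.tendsto_id.const_mul_atBot hp2)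
  set e := hmono.orderIsoOfSurjective S hsurj
  refine ⟨e.symm, fun t => ?_⟩
  have hSe : ∀ t, S (e.symm t) = t := fun t => e.apply_symm_apply t
  have h := HasDerivAt.of_local_left_inverse (f := S) (g := e.symm) (a := t)
    e.symm.continuous.continuousAt (hder _) (div_pos (hpos _) hp1).ne'
    (Filter.Eventually.of_forall hSe)
  rwa [inv_div] at h

/-- The profiles of the exponential solutions `x ↦ exp(x·ξ) a(x·η)` of the `p`-Laplace equation,
in polar coordinates `a = exp(κ sin² θ) cos θ`, `a' = -exp(κ sin² θ) sin θ`. -/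
lemma exists_profile (hp : 1 < p) : ∃ (θ : ℝ → ℝ) (κ : ℝ), ContDiff ℝ 1 θ ∧
    (∀ t, HasDerivAt (fun t => Real.exp (κ * Real.sin (θ t) ^ 2) * Real.cos (θ t))
      (-(Real.exp (κ * Real.sin (θ t) ^ 2) * Real.sin (θ t))) t) ∧
    (∀ t, HasDerivAt (fun t => Real.exp ((p - 1) * (κ * Real.sin (θ t) ^ 2)) * Real.sin (θ t))
      ((p - 1) * (Real.exp ((p - 1) * (κ * Real.sin (θ t) ^ 2)) * Real.cos (θ t))) t) := by
  have hp1 : p - 1 ≠ 0 := by linarith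
  obtain ⟨θ, hθ⟩ := exists_angle hp
  have hpos : ∀ y : ℝ, 1 + (p - 2) * Real.sin y ^ 2 ≠ 0 := fun y =>
    (one_add_mul_sin_sq_pos hp y).ne'
  have hcont : Continuous θ := continuous_iff_continuousAt.2 fun t => (hθ t).continuousAt
  -- This κ makes both identities hold: that the second polar component is the derivative of the
  -- first, and that the flux is divergence free.
  refine ⟨θ, (p - 2) / (2 * (p - 1)), ?_, fun t => ?_, fun t => ?_⟩
  · rw [contDiff_one_iff_deriv]
    refine ⟨fun t => (hθ t).differentiableAt, ?_⟩
    rw [show deriv θ = fun t => (p - 1) / (1 + (p - 2) * Real.sin (θ t) ^ 2) from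
      funext fun t => (hθ t).deriv]
    exact continuous_const.div (by fun_prop) fun t => hpos _
  · have h := ((((hθ t).sin.pow 2).const_mul ((p - 2) / (2 * (p - 1)))).exp).mul (hθ t).cos
    refine h.congr_deriv ?_
    have h1 := div_mul_cancel₀ (p - 1) (hpos (θ t))
    have h2 := div_mul_cancel₀ (p - 2) (mul_ne_zero two_ne_zero hp1)
    have h3 := Real.sin_sq_add_cos_sq (θ t)
    push_cast
    generalize (p - 1) / (1 + (p - 2) * Real.sin (θ t) ^ 2) = T at h1 ⊢
    generalize (p - 2) / (2 * (p - 1)) = κ at h2 ⊢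
    have h4 : (p - 1) * (T * (2 * κ * Real.cos (θ t) ^ 2 - 1) + 1) = 0 := by
      linear_combination T * Real.cos (θ t) ^ 2 * h2 - h1 + T * (p - 2) * h3
    have h5 := (mul_eq_zero.1 h4).resolve_left hp1
    linear_combination Real.exp (κ * Real.sin (θ t) ^ 2) * Real.sin (θ t) * h5
  · have h := (((((hθ t).sin.pow 2).const_mul ((p - 2) / (2 * (p - 1)))).const_mul
      (p - 1)).exp).mul (hθ t).sin
    refine h.congr_deriv ?_
    have h1 := div_mul_cancel₀ (p - 1) (hpos (θ t))
    have h2 := div_mul_cancel₀ (p - 2) (mul_ne_zero two_ne_zero hp1)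
    push_cast
    generalize (p - 1) / (1 + (p - 2) * Real.sin (θ t) ^ 2) = T at h1 ⊢
    generalize (p - 2) / (2 * (p - 1)) = κ at h2 ⊢
    linear_combination Real.exp ((p - 1) * (κ * Real.sin (θ t) ^ 2)) * Real.cos (θ t) *
      (T * Real.sin (θ t) ^ 2 * h2 + h1)

variable {n : ℕ}

lemma hasFDerivAt_exp_inner_mul {b : ℝ → ℝ} {b' : ℝ} (c : ℝ) (ξ η x : E n)
    (hb : HasDerivAt b b' (inner ℝ η x)) :
    HasFDerivAt (fun x : E n => Real.exp (c * inner ℝ ξ x) * b (inner ℝ η x))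
      (Real.exp (c * inner ℝ ξ x) • (c * b (inner ℝ η x)) • innerSL ℝ ξ +
        Real.exp (c * inner ℝ ξ x) • b' • innerSL ℝ η) x := by
  have h1 : HasFDerivAt (fun x : E n => c * inner ℝ ξ x) (c • innerSL ℝ ξ) x :=
    (innerSL ℝ ξ).hasFDerivAt.const_mul c
  have h2 : HasFDerivAt (fun x : E n => (inner ℝ η x : ℝ)) (innerSL ℝ η) x :=
    (innerSL ℝ η).hasFDerivAt
  have h3 : HasFDerivAt (fun x : E n => b (inner ℝ η x)) (b' • innerSL ℝ η) x :=
    hb.comp_hasFDerivAt x h2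
  refine (h1.exp.mul h3).congr_fderiv ?_
  ext v
  simp only [add_apply, smul_apply, smul_eq_mul]
  ring

lemma contDiff_exp_inner_mul {b : ℝ → ℝ} (hb : ContDiff ℝ 1 b) (c : ℝ) (ξ η : E n) :
    ContDiff ℝ 1 fun x : E n => Real.exp (c * inner ℝ ξ x) * b (inner ℝ η x) := by
  have h1 : ContDiff ℝ 1 fun x : E n => (inner ℝ ξ x : ℝ) := contDiff_const.inner ℝ contDiff_id
  have h2 : ContDiff ℝ 1 fun x : E n => (inner ℝ η x : ℝ) := contDiff_const.inner ℝ contDiff_id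
  exact (contDiff_const.mul h1).exp.mul (hb.comp h2)

variable [hp : Fact (1 < p)] {Ω : Set (E n)}

/-- Density of the test functions in W_0^{1,p} and continuity of the flux functional. -/
lemma fluxForm_eq_zero_of_test {σ : E n → ℝ} (hσ : IsConductivity Ω σ) {u : W1p Ω p}
    (h : ∀ w ∈ testSubmodule Ω p, fluxForm Ω σ u w = 0) :
    ∀ w ∈ W01p Ω p, fluxForm Ω σ u w = 0 := by
  have hcl : IsClosed {w : W1p Ω p | fluxCLM hσ u w = 0} :=
    isClosed_eq (fluxCLM hσ u).continuous continuous_const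
  exact fun w hw => closure_minimal (s := (testSubmodule Ω p : Set (W1p Ω p))) h hcl hw

set_option maxHeartbeats 1000000 in
/-- Exponentially growing solutions of the `p`-Laplace equation. -/
lemma exists_exponential_solution (p : ℝ) [hp : Fact (1 < p)] : ∃ M : ℝ, 0 < M ∧
    ∀ {n : ℕ} {Ω : Set (E n)}, IsOpen Ω → Bornology.IsBounded Ω → ∀ ξ η : E n, ξ ≠ 0 →
      ‖η‖ = ‖ξ‖ → inner ℝ ξ η = (0 : ℝ) → ∃ u : W1p Ω p, IsMinimizer (fun _ => 1) (trace u) u ∧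
        ∀ᵐ x ∂(volume.restrict Ω), M⁻¹ * (‖ξ‖ * Real.exp (inner ℝ ξ x)) ≤ ‖grad u x‖ ∧
          ‖grad u x‖ ≤ M * (‖ξ‖ * Real.exp (inner ℝ ξ x)) := by
  obtain ⟨θ, κ, hθ, ha, hb⟩ := exists_profile hp.out
  refine ⟨Real.exp |κ|, Real.exp_pos _, ?_⟩
  intro n Ω hΩ hΩb ξ η hξ hη hξη
  have hl : 0 < ‖ξ‖ := norm_pos_iff.2 hξ
  set a : ℝ → ℝ := fun t => Real.exp (κ * Real.sin (θ t) ^ 2) * Real.cos (θ t)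
  set b₁ : ℝ → ℝ := fun t => Real.exp ((p - 1) * (κ * Real.sin (θ t) ^ 2)) * Real.cos (θ t)
  set b₂ : ℝ → ℝ := fun t => Real.exp ((p - 1) * (κ * Real.sin (θ t) ^ 2)) * Real.sin (θ t)
  have ca : ContDiff ℝ 1 a := by fun_prop
  have cb₁ : ContDiff ℝ 1 b₁ := by fun_prop
  have cb₂ : ContDiff ℝ 1 b₂ := by fun_prop
  set h : E n → ℝ := fun x => Real.exp (1 * inner ℝ ξ x) * a (inner ℝ η x) with hh
  have ch : ContDiff ℝ 1 h := contDiff_exp_inner_mul ca 1 ξ η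
  -- As ξ and η are orthogonal of equal length, |∇h| = |ξ| R. The oscillating factor exp(κ sin² θ)
  -- lies between exp(-|κ|) and exp(|κ|), so the final constant depends only on p.
  set R : E n → ℝ := fun x => Real.exp (inner ℝ ξ x + κ * Real.sin (θ (inner ℝ η x)) ^ 2) with hR
  have hgrad : ∀ x, gradient h x = (R x * Real.cos (θ (inner ℝ η x))) • ξ -
      (R x * Real.sin (θ (inner ℝ η x))) • η := by
    intro x
    refine ext_inner_right ℝ fun v => ?_
    rw [inner_gradient, (hasFDerivAt_exp_inner_mul 1 ξ η x (ha _)).fderiv]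
    simp only [add_apply, smul_apply, smul_eq_mul, innerSL_apply_apply, inner_sub_left,
      real_inner_smul_left, hR, Real.exp_add, one_mul]
    ring
  have hnorm : ∀ x, ‖gradient h x‖ = ‖ξ‖ * R x := by
    intro x
    have hR0 : 0 < R x := Real.exp_pos _
    rw [← sq_eq_sq₀ (norm_nonneg _) (by positivity), hgrad, norm_sub_sq_real, norm_smul, norm_smul,
      real_inner_smul_left, real_inner_smul_right, hξη, hη, mul_pow, mul_pow, Real.norm_eq_abs,
      Real.norm_eq_abs, sq_abs, sq_abs]
    linear_combination (R x) ^ 2 * ‖ξ‖ ^ 2 * Real.sin_sq_add_cos_sq (θ (inner ℝ η x))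
  obtain ⟨u, hu⟩ := exists_W1p_of_contDiff (p := p) hΩ hΩb ch
  refine ⟨u, isMinimizer_of_fluxForm_eq_zero isConductivity_one
    (fluxForm_eq_zero_of_test isConductivity_one ?_), ?_⟩
  · rintro w ⟨φ, hφ, hwφ⟩
    set g₁ : E n → ℝ := fun x => Real.exp ((p - 1) * inner ℝ ξ x) * b₁ (inner ℝ η x)
    set g₂ : E n → ℝ := fun x => Real.exp ((p - 1) * inner ℝ ξ x) * b₂ (inner ℝ η x)
    have cg₁ : ContDiff ℝ 1 g₁ := contDiff_exp_inner_mul cb₁ _ ξ η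
    have cg₂ : ContDiff ℝ 1 g₂ := contDiff_exp_inner_mul cb₂ _ ξ η
    have hflux : ∀ x v, ‖gradient h x‖ ^ (p - 2) * inner ℝ (gradient h x) v =
        ‖ξ‖ ^ (p - 2) * (g₁ x * inner ℝ ξ v - g₂ x * inner ℝ η v) := by
      intro x v
      have hR0 : 0 < R x := Real.exp_pos _
      have hRp : R x ^ (p - 2) * R x = Real.exp ((p - 1) * inner ℝ ξ x) *
          Real.exp ((p - 1) * (κ * Real.sin (θ (inner ℝ η x)) ^ 2)) := by
        rw [← Real.rpow_add_one hR0.ne', ← Real.exp_add, hR, ← Real.exp_mul]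
        congr 1; ring
      rw [hnorm, hgrad, Real.mul_rpow hl.le hR0.le, inner_sub_left, real_inner_smul_left,
        real_inner_smul_left]
      simp only [g₁, g₂, b₁, b₂]
      linear_combination ‖ξ‖ ^ (p - 2) * (Real.cos (θ (inner ℝ η x)) * inner ℝ ξ v -
        Real.sin (θ (inner ℝ η x)) * inner ℝ η v) * hRp
    -- Up to the factor |ξ|^(p-2) the flux is g₁ξ - g₂η, so this says its divergence vanishes; it is
    -- the second profile equation.
    have hder : ∀ x, fderiv ℝ g₁ x ξ = fderiv ℝ g₂ x η := by
      intro x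
      have hb₁ := (cb₁.differentiable one_ne_zero (inner ℝ η x)).hasDerivAt
      rw [(hasFDerivAt_exp_inner_mul (p - 1) ξ η x hb₁).fderiv,
        (hasFDerivAt_exp_inner_mul (p - 1) ξ η x (hb _)).fderiv]
      simp only [add_apply, smul_apply, smul_eq_mul, innerSL_apply_apply, hξη,
        real_inner_comm ξ η, real_inner_self_eq_norm_sq, hη, b₁]
      ring
    have i₁ : Integrable (fun x => g₁ x * fderiv ℝ φ x ξ) (volume.restrict Ω) :=
      hφ.integrable_deriv cg₁.continuous.locallyIntegrable ξ
    have i₂ : Integrable (fun x => g₂ x * fderiv ℝ φ x η) (volume.restrict Ω) :=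
      hφ.integrable_deriv cg₂.continuous.locallyIntegrable η
    have hw := grad_ae_eq_gradient hΩ (hφ.smooth.of_le (by simp)) hwφ
    calc fluxForm Ω (fun _ => 1) u w = ∫ x in Ω, ‖ξ‖ ^ (p - 2) *
          (g₁ x * fderiv ℝ φ x ξ - g₂ x * fderiv ℝ φ x η) := by
          refine integral_congr_ae ?_
          filter_upwards [hu, hw] with x h1 h2
          rw [h1, h2, one_mul, hflux, real_inner_comm, inner_gradient, real_inner_comm,
            inner_gradient]
      _ = 0 := by
          rw [integral_const_mul, integral_sub i₁ i₂, hφ.integral_mul_fderiv cg₁,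
            hφ.integral_mul_fderiv cg₂]
          simp only [hder, sub_self, mul_zero]
  · filter_upwards [hu] with x hx
    rw [hx, hnorm, hR, ← Real.exp_neg]
    have hs1 : Real.sin (θ (inner ℝ η x)) ^ 2 ≤ 1 := Real.sin_sq_le_one _
    have hk : |κ * Real.sin (θ (inner ℝ η x)) ^ 2| ≤ |κ| := by
      rw [abs_mul, abs_of_nonneg (sq_nonneg (Real.sin _))]
      exact mul_le_of_le_one_right (abs_nonneg _) hs1
    have hk' := abs_le.1 hk
    constructor
    · rw [mul_left_comm, ← Real.exp_add]
      exact mul_le_mul_of_nonneg_left (Real.exp_le_exp.2 (by linarith)) hl.le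
    · rw [mul_left_comm, ← Real.exp_add]
      exact mul_le_mul_of_nonneg_left (Real.exp_le_exp.2 (by linarith)) hl.le

end Exponential

/-! ### Separation of a set from the closed essential convex hull -/

section Hull

variable {n : ℕ} {Ω : Set (E n)} {σ : E n → ℝ}

/-- The union removed in `essSupp` may be uncountable, but a set that is null near each of its
points is null. -/
lemma ae_eq_one_of_notMem_essSupp (Ω : Set (E n)) (σ : E n → ℝ) :
    ∀ᵐ x ∂(volume : Measure (E n)), x ∈ Ω → x ∉ essSupp Ω (fun x => |σ x - 1|) → σ x = 1 := by
  have h : {x | ¬(x ∈ Ω → x ∉ essSupp Ω (fun x => |σ x - 1|) → σ x = 1)} =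
      {x | x ∈ Ω ∧ x ∉ essSupp Ω (fun x => |σ x - 1|) ∧ σ x ≠ 1} := by
    ext x; simp
  rw [ae_iff, h]
  refine measure_null_of_locally_null _ fun x hx => ?_
  obtain ⟨hxΩ, hxD, -⟩ := hx
  have hxO : x ∈ ⋃₀ {O : Set (E n) | IsOpen O ∧ O ⊆ Ω ∧
      ∀ᵐ x ∂(volume.restrict O), |σ x - 1| = 0} := by
    by_contra hcon
    exact hxD ⟨hxΩ, hcon⟩
  obtain ⟨O, ⟨hO, -, hσO⟩, hxO⟩ := hxO
  refine ⟨_, inter_mem_nhdsWithin _ (hO.mem_nhds hxO), ?_⟩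
  rw [ae_restrict_iff' hO.measurableSet, ae_iff] at hσO
  refine measure_mono_null ?_ hσO
  rintro y ⟨⟨-, -, hy⟩, hyO⟩
  simp only [mem_ofPred_eq, Classical.not_imp]
  exact ⟨hyO, by rw [abs_eq_zero, sub_eq_zero]; exact hy⟩

/-- The open half-space is a countable union of smaller ones. The gap gained between the two levels
is what the exponential solutions amplify. -/
lemma exists_lt_measure_inter_pos {B : Set (E n)} {ρ : E n} {t : ℝ}
    (h : volume (B ∩ {x | t < inner ℝ x ρ}) ≠ 0) :
    ∃ t', t < t' ∧ volume (B ∩ {x | t' < inner ℝ x ρ}) ≠ 0 := by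
  by_contra! hcon
  refine h (measure_mono_null ?_ (measure_iUnion_null
    (s := fun k : ℕ => B ∩ {x | t + 1 / ((k : ℝ) + 1) < inner ℝ x ρ}) fun k =>
      hcon _ (lt_add_of_pos_right _ (by positivity))))
  rintro x ⟨hxB, hx⟩
  have hx' : t < inner ℝ x ρ := hx
  obtain ⟨k, hk⟩ := exists_nat_one_div_lt (sub_pos.2 hx')
  exact mem_iUnion.2 ⟨k, hxB, by simp only [mem_ofPred_eq]; linarith⟩

/-- If `B` is not essentially contained in the closed essential convex hull, some half-space
separates a non-null part of `B` from the essential support. -/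
lemma exists_separating_halfSpace (hn : 2 ≤ n) (hΩb : Bornology.IsBounded Ω) {B : Set (E n)}
    (hBΩ : B ⊆ Ω) (hB : volume (B \ cessco (essSupp Ω (fun x => |σ x - 1|))) ≠ 0) :
    ∃ (ρ : E n) (t t' : ℝ), ρ ≠ 0 ∧ t < t' ∧
      (∀ᵐ x ∂(volume : Measure (E n)), x ∈ Ω → t < inner ℝ x ρ → σ x = 1) ∧
      volume (B ∩ {x | t' < inner ℝ x ρ}) ≠ 0 := by
  set D := essSupp Ω (fun x => |σ x - 1|) with hD
  obtain ⟨ρ, t, hρt, hBρ⟩ : ∃ (ρ : E n) (t : ℝ), volume (D \ halfSpace ρ t) = 0 ∧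
      volume (B ∩ {x | t < inner ℝ x ρ}) ≠ 0 := by
    by_contra! hcon
    -- Each point outside the hull lies in the open complement of an admissible half-space; if all
    -- of these met `B` in null sets, `B` minus the hull would be locally null.
    refine hB (measure_null_of_locally_null _ fun x hx => ?_)
    obtain ⟨hxB, hxc⟩ := hx
    simp only [cessco, mem_iInter, not_forall] at hxc
    obtain ⟨ρ, t, hρt, hxρ⟩ := hxc
    have hopen : IsOpen {x : E n | t < inner ℝ x ρ} :=
      isOpen_lt continuous_const (continuous_id.inner continuous_const)
    have hxt : t < inner ℝ x ρ := lt_of_not_ge hxρ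
    refine ⟨_, inter_mem_nhdsWithin _ (hopen.mem_nhds hxt), ?_⟩
    exact measure_mono_null (inter_subset_inter_left _ sdiff_subset) (hcon ρ t hρt)
  have hσ1 : ∀ᵐ x ∂(volume : Measure (E n)), x ∈ Ω → t < inner ℝ x ρ → σ x = 1 := by
    have h1 : ∀ᵐ x ∂(volume : Measure (E n)), x ∉ D \ halfSpace ρ t :=
      measure_eq_zero_iff_ae_notMem.1 hρt
    filter_upwards [h1, ae_eq_one_of_notMem_essSupp Ω σ] with x hx hx2 hxΩ hxt
    exact hx2 hxΩ fun hxD => hx ⟨hxD, not_le.2 hxt⟩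
  -- For ρ = 0 the closed half-space must be empty, so σ = 1 a.e. in Ω. Any unit direction then
  -- serves, with both levels chosen below all values attained on the bounded set Ω.
  rcases eq_or_ne ρ 0 with rfl | hρ
  · have ht : t < 0 := by
      by_contra ht
      simp [inner_zero_right, ht] at hBρ
    obtain ⟨R, hR⟩ := hΩb.exists_norm_le
    set ρ₁ : E n := EuclideanSpace.single ⟨0, by omega⟩ 1
    have hρ₁ : ‖ρ₁‖ = 1 := by simp [ρ₁]
    refine ⟨ρ₁, -R - 2, -R - 1, norm_ne_zero_iff.1 (by rw [hρ₁]; exact one_ne_zero), by linarith,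
      ?_, ?_⟩
    · filter_upwards [hσ1] with x hx hxΩ _
      exact hx hxΩ (by rwa [inner_zero_right])
    · refine fun h0 => hBρ (measure_mono_null ?_ h0)
      rintro x ⟨hxB, -⟩
      refine ⟨hxB, ?_⟩
      have h1 := abs_le.1 (abs_real_inner_le_norm x ρ₁)
      have h2 := hR x (hBΩ hxB)
      rw [hρ₁, mul_one] at h1
      simp only [mem_ofPred_eq]
      linarith
  · obtain ⟨t', ht, ht'⟩ := exists_lt_measure_inter_pos hBρ
    exact ⟨ρ, t, t', hρ, ht, hσ1, ht'⟩

/-- A linear functional on a space of dimension at least 2 has a nonzero kernel vector, which is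
then rescaled. -/
lemma exists_orthogonal (hn : 2 ≤ n) (ρ : E n) :
    ∃ η : E n, ‖η‖ = ‖ρ‖ ∧ inner ℝ ρ η = (0 : ℝ) := by
  obtain ⟨v, hv0, hv⟩ : ∃ v : E n, v ≠ 0 ∧ inner ℝ ρ v = (0 : ℝ) := by
    by_contra! hcon
    have hinj : Function.Injective (innerₛₗ ℝ ρ : E n →ₗ[ℝ] ℝ) := by
      rw [← LinearMap.ker_eq_bot, LinearMap.ker_eq_bot']
      intro v hv
      by_contra h
      exact hcon v h hv
    have := LinearMap.finrank_le_finrank_of_injective hinj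
    rw [finrank_euclideanSpace_fin, Module.finrank_self] at this
    omega
  refine ⟨(‖ρ‖ / ‖v‖) • v, ?_, ?_⟩
  · rw [norm_smul, norm_div, norm_norm, norm_norm, div_mul_cancel₀ _ (norm_ne_zero_iff.2 hv0)]
  · rw [real_inner_smul_right, hv, mul_zero]

end Hull

/-! ### Energy comparison, uniqueness and concentration -/

section Comparison

variable {n : ℕ} {Ω : Set (E n)} {p : ℝ} [hp : Fact (1 < p)] {σ : E n → ℝ}

lemma IsConductivity.memLp_rpow (hσ : IsConductivity Ω σ) {q : ℝ} (hq : q ≤ 0) :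
    MemLp (fun x => σ x ^ q) ⊤ (volume.restrict Ω) := by
  obtain ⟨c, hc, h⟩ := hσ.2
  refine memLp_top_of_bound (hσ.1.1.aemeasurable.pow_const q).aestronglyMeasurable (c ^ q) ?_
  filter_upwards [h] with x hx
  rw [Real.norm_of_nonneg (Real.rpow_nonneg (hc.le.trans hx) _)]
  exact Real.rpow_le_rpow_of_nonpos hc hx hq

lemma energy_one (u : W1p Ω p) : energy (fun _ => 1) u = ∫ x in Ω, ‖grad u x‖ ^ p := by
  simp only [energy, one_mul]

/-- The difference v - u lies in W_0^{1,p}, where the Euler-Lagrange equation annihilates the flux.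
-/
lemma IsMinimizer.fluxForm_eq_energy {f : X Ω p} {u v : W1p Ω p}
    (hu : IsMinimizer (fun _ => 1) f u) (hv : trace v = f) :
    fluxForm Ω (fun _ => 1) u v = energy (fun _ => 1) u := by
  obtain ⟨d, hd⟩ : ∃ d : W1p Ω p, d = v - u := ⟨_, rfl⟩
  have hd' : d ∈ W01p Ω p := by rw [hd]; exact trace_eq_trace_iff.1 (hv.trans hu.1.symm)
  obtain rfl : v = u + d := by rw [hd, add_sub_cancel]
  rw [fluxForm_add isConductivity_one, hu.fluxForm_eq_zero isConductivity_one hd', add_zero,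
    fluxForm_self, energy]

/-- The lower bound for the energy that comes from Young's inequality. -/
lemma IsMinimizer.mul_energy_le (hσ : IsConductivity Ω σ) {f : X Ω p} {u v : W1p Ω p}
    (hu : IsMinimizer (fun _ => 1) f u) (hv : trace v = f) :
    p * energy (fun _ => 1) u ≤ energy σ v +
      (p - 1) * ∫ x in Ω, σ x ^ (-(1 / (p - 1))) * ‖grad u x‖ ^ p := by
  have hp1 : 0 < p - 1 := by linarith [hp.out]
  have hq : -(1 / (p - 1)) ≤ 0 := by rw [neg_nonpos]; positivity
  obtain ⟨c, hc, hσc⟩ := hσ.2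
  have i1 := hσ.integrable_mul (integrable_rpow_grad v)
  have i2 : Integrable (fun x => σ x ^ (-(1 / (p - 1))) * ‖grad u x‖ ^ p) (volume.restrict Ω) :=
    (integrable_rpow_grad u).mul_of_top_right (hσ.memLp_rpow hq)
  rw [← hu.fluxForm_eq_energy hv, fluxForm, energy, ← integral_const_mul, ← integral_const_mul,
    ← integral_add i1 (i2.const_mul _)]
  refine integral_mono_ae ((isConductivity_one.integrable_mul (integrable_flux u v)).const_mul p)
    (i1.add (i2.const_mul _)) ?_
  filter_upwards [hσc] with x hx
  have := mul_rpow_mul_inner_le hp.out (hc.trans_le hx) (grad u x) (grad v x)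
  rw [one_mul]
  linarith

/-- The midpoint of two minimizers cannot have smaller energy, so uniform convexity makes the energy
of their difference smaller than any ε. -/
lemma IsMinimizer.grad_ae_eq {f : X Ω p} {u v : W1p Ω p} (hσ : IsConductivity Ω σ)
    (hu : IsMinimizer σ f u) (hv : IsMinimizer σ f v) : grad u =ᵐ[volume.restrict Ω] grad v := by
  have hE : energy σ v = energy σ u := le_antisymm (hv.2 u hu.1) (hu.2 v hv.1)
  have hmid := hu.2 _ ((trace_midpoint (hu.1.trans hv.1.symm)).trans hv.1)
  have hle : ∀ ε : ℝ, 0 < ε → energy σ (u - v) ≤ ε := by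
    intro ε hε
    have hδ : 0 < ε / (2 * energy σ u + 1) :=
      div_pos hε (by linarith [energy_nonneg hσ u])
    obtain ⟨C, hC, h⟩ := exists_energy_sub_le (Ω := Ω) (p := p) hσ hδ
    refine (h u v).trans ?_
    rw [hE]
    have h1 : C * ((energy σ u + energy σ u) / 2 - energy σ ((1 / 2 : ℝ) • (u + v))) ≤ 0 :=
      mul_nonpos_of_nonneg_of_nonpos hC (by linarith)
    have h2 := energy_nonneg hσ u
    have h3 : ε / (2 * energy σ u + 1) * (2 * energy σ u + 1) = ε :=
      div_mul_cancel₀ _ (by linarith)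
    linarith
  have h0 : energy σ (u - v) = 0 :=
    le_antisymm (le_of_forall_pos_le_add fun ε hε => by rw [zero_add]; exact hle ε hε)
      (energy_nonneg hσ _)
  obtain ⟨c, hc, hσc⟩ := hσ.2
  have hnn : 0 ≤ᵐ[volume.restrict Ω] fun x => σ x * ‖grad (u - v) x‖ ^ p := by
    filter_upwards [hσ.nonneg] with x hx
    exact mul_nonneg hx (by positivity)
  have h1 := (integral_eq_zero_iff_of_nonneg_ae hnn
    (hσ.integrable_mul (integrable_rpow_grad (u - v)))).1 h0
  filter_upwards [h1, hσc, grad_sub u v] with x h1 h2 h3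
  have h4 : σ x ≠ 0 := (hc.trans_le h2).ne'
  have h5 := (mul_eq_zero.1 h1).resolve_left h4
  rw [Real.rpow_eq_zero (norm_nonneg _) (by linarith [hp.out]), norm_eq_zero, h3] at h5
  exact sub_eq_zero.1 h5

lemma restrict_restrict_of_subset {B : Set (E n)} (hBΩ : B ⊆ Ω)
    (hB : NullMeasurableSet B volume) :
    ((volume : Measure (E n)).restrict Ω).restrict B = volume.restrict B := by
  rw [Measure.restrict_restrict₀ (hB.mono_ac Measure.restrict_le_self.absolutelyContinuous),
    inter_eq_left.2 hBΩ]

lemma setIntegral_eq_indicator {B : Set (E n)} (hBΩ : B ⊆ Ω) (hB : NullMeasurableSet B volume)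
    (g : E n → ℝ) : ∫ x in B, g x = ∫ x in Ω, B.indicator g x := by
  rw [integral_indicator₀ (hB.mono_ac Measure.restrict_le_self.absolutelyContinuous),
    restrict_restrict_of_subset hBΩ hB]

lemma ae_restrict_of_ae_restrict_subset {B : Set (E n)} (hBΩ : B ⊆ Ω)
    (hB : NullMeasurableSet B volume) {P : E n → Prop} (h : ∀ᵐ x ∂(volume.restrict B), P x) :
    ∀ᵐ x ∂(volume.restrict Ω), x ∈ B → P x := by
  rw [← restrict_restrict_of_subset hBΩ hB] at h
  exact (ae_restrict_iff'₀ (hB.mono_ac Measure.restrict_le_self.absolutelyContinuous)).1 h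

/-- Concentration: some solution for the conductivity `1` has its energy concentrated in a given
half-space. -/
lemma exists_concentrating_solution (hn : 2 ≤ n) (hΩ : IsOpen Ω) (hΩb : Bornology.IsBounded Ω)
    {B : Set (E n)} (hBΩ : B ⊆ Ω) (hB : NullMeasurableSet B volume) {ρ : E n} {t t' α : ℝ}
    (hα : 0 < α) (hρ : ρ ≠ 0) (htt : t < t') (hBt : volume (B ∩ {x | t' < inner ℝ x ρ}) ≠ 0)
    {k : E n → ℝ} (hk : MemLp k ⊤ (volume.restrict Ω))
    (hk0 : ∀ᵐ x ∂(volume.restrict Ω), t < inner ℝ x ρ → k x = 0) :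
    ∃ u : W1p Ω p, IsMinimizer (fun _ => 1) (trace u) u ∧
      ∫ x in Ω, k x * ‖grad u x‖ ^ p < α * ∫ x in B, ‖grad u x‖ ^ p := by
  have hp0 : 0 < p := by linarith [hp.out]
  obtain ⟨M, hM, hMu⟩ := exists_exponential_solution p
  obtain ⟨η, hη, hρη⟩ := exists_orthogonal hn ρ
  obtain ⟨K, hK0, hK⟩ : ∃ K : ℝ, 0 ≤ K ∧ ∀ᵐ x ∂(volume.restrict Ω), k x ≤ K := by
    refine ⟨(eLpNormEssSup k (volume.restrict Ω)).toReal, ENNReal.toReal_nonneg, ?_⟩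
    have hfin : eLpNormEssSup k (volume.restrict Ω) ≠ ⊤ := by
      simpa using hk.eLpNorm_ne_top
    filter_upwards [ae_le_eLpNormEssSup (f := k) (μ := volume.restrict Ω)] with x hx
    refine (le_abs_self _).trans ?_
    simpa using ENNReal.toReal_mono hfin hx
  set B' := B ∩ {x | t' < inner ℝ x ρ} with hB'
  have hopen : IsOpen {x : E n | t' < inner ℝ x ρ} :=
    isOpen_lt continuous_const (continuous_id.inner continuous_const)
  have hB'm : NullMeasurableSet B' volume := hB.inter hopen.measurableSet.nullMeasurableSet
  have hB'Ω : B' ⊆ Ω := inter_subset_left.trans hBΩ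
  have hΩfin : volume Ω ≠ ⊤ := hΩb.measure_lt_top.ne
  have hB'fin : volume B' ≠ ⊤ := ne_top_of_le_ne_top hΩfin (measure_mono hB'Ω)
  have hfinΩ : IsFiniteMeasure (volume.restrict Ω) := ⟨by simpa using hΩfin.lt_top⟩
  have hfinB : IsFiniteMeasure (volume.restrict B') := ⟨by simpa using hB'fin.lt_top⟩
  set b := volume.real B' with hb
  have hb0 : 0 < b := ENNReal.toReal_pos hBt hB'fin
  set V := volume.real Ω with hV
  have hV0 : 0 ≤ V := ENNReal.toReal_nonneg
  have hρ0 : 0 < ‖ρ‖ := norm_pos_iff.2 hρ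
  -- `Q` is the ratio of the constants in the upper bound over Ω and the lower bound over `B'`. The
  -- frequency `τ` below is chosen so that exp(pτ(t'-t)) = exp(Q+1), which exceeds `Q`.
  set Q := K * M ^ p * V / (α * (M⁻¹) ^ p * b) with hQ
  have hQ0 : 0 ≤ Q := by positivity
  set τ := (Q + 1) / (p * (t' - t)) with hτ
  have htt' : 0 < t' - t := sub_pos.2 htt
  have hτ0 : 0 < τ := by positivity
  obtain ⟨u, hu, hgu⟩ := hMu hΩ hΩb (τ • ρ) (τ • η) (smul_ne_zero hτ0.ne' hρ)
    (by rw [norm_smul, norm_smul, hη])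
    (by rw [real_inner_smul_left, real_inner_smul_right, hρη, mul_zero, mul_zero])
  have hin : ∀ x : E n, inner ℝ (τ • ρ) x = τ * inner ℝ x ρ := fun x => by
    rw [real_inner_smul_left, real_inner_comm]
  have hnτ : ‖τ • ρ‖ = τ * ‖ρ‖ := by rw [norm_smul, Real.norm_of_nonneg hτ0.le]
  simp only [hin, hnτ] at hgu
  have hl : 0 < τ * ‖ρ‖ := by positivity
  refine ⟨u, hu, ?_⟩
  have hi := integrable_rpow_grad u
  have h1 : ∫ x in Ω, k x * ‖grad u x‖ ^ p ≤
      K * (M * (τ * ‖ρ‖ * Real.exp (τ * t))) ^ p * V := by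
    have : ∫ _ in Ω, K * (M * (τ * ‖ρ‖ * Real.exp (τ * t))) ^ p =
        K * (M * (τ * ‖ρ‖ * Real.exp (τ * t))) ^ p * V := by
      rw [setIntegral_const, smul_eq_mul, mul_comm]
    rw [← this]
    refine integral_mono_ae (hi.mul_of_top_right hk) (integrable_const _) ?_
    filter_upwards [hgu, hK, hk0] with x hx1 hx2 hx3
    by_cases hxt : t < inner ℝ x ρ
    · rw [hx3 hxt, zero_mul]; positivity
    · have h2 : Real.exp (τ * inner ℝ x ρ) ≤ Real.exp (τ * t) :=
        Real.exp_le_exp.2 (mul_le_mul_of_nonneg_left (not_lt.1 hxt) hτ0.le)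
      have h3 : ‖grad u x‖ ≤ M * (τ * ‖ρ‖ * Real.exp (τ * t)) :=
        hx1.2.trans (by gcongr)
      calc k x * ‖grad u x‖ ^ p ≤ K * ‖grad u x‖ ^ p := by gcongr
        _ ≤ _ := by gcongr
  have h2 : (M⁻¹ * (τ * ‖ρ‖ * Real.exp (τ * t'))) ^ p * b ≤ ∫ x in B, ‖grad u x‖ ^ p := by
    have hiB : IntegrableOn (fun x => ‖grad u x‖ ^ p) B volume := hi.mono_measure
      (Measure.restrict_mono hBΩ le_rfl)
    have h3 : ∫ x in B', ‖grad u x‖ ^ p ≤ ∫ x in B, ‖grad u x‖ ^ p :=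
      setIntegral_mono_set hiB (ae_of_all _ fun x => by positivity)
        (ae_of_all _ fun x hx => hx.1)
    refine le_trans ?_ h3
    have : ∫ _ in B', (M⁻¹ * (τ * ‖ρ‖ * Real.exp (τ * t'))) ^ p =
        (M⁻¹ * (τ * ‖ρ‖ * Real.exp (τ * t'))) ^ p * b := by
      rw [setIntegral_const, smul_eq_mul, mul_comm]
    rw [← this]
    refine integral_mono_ae (integrable_const _) (hi.mono_measure
      (Measure.restrict_mono hB'Ω le_rfl)) ?_
    filter_upwards [ae_restrict_of_ae_restrict_of_subset hB'Ω hgu, ae_restrict_mem₀ hB'm]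
      with x hx1 hx2
    have h2 : Real.exp (τ * t') ≤ Real.exp (τ * inner ℝ x ρ) :=
      Real.exp_le_exp.2 (mul_le_mul_of_nonneg_left hx2.2.le hτ0.le)
    have h3 : M⁻¹ * (τ * ‖ρ‖ * Real.exp (τ * t')) ≤ ‖grad u x‖ :=
      le_trans (by gcongr) hx1.1
    gcongr
  refine h1.trans_lt (lt_of_lt_of_le ?_ (mul_le_mul_of_nonneg_left h2 hα.le))
  have e1 : ∀ m s : ℝ, 0 < m → (m * (τ * ‖ρ‖ * Real.exp (τ * s))) ^ p =
      m ^ p * (τ * ‖ρ‖) ^ p * Real.exp (p * (τ * s)) := by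
    intro m s hm
    rw [Real.mul_rpow hm.le (by positivity), Real.mul_rpow hl.le (by positivity), ← Real.exp_mul,
      mul_comm p]
    ring
  rw [e1 _ _ hM, e1 _ _ (inv_pos.2 hM)]
  have hexp : Real.exp (p * (τ * t')) = Real.exp (p * (τ * t)) * Real.exp (Q + 1) := by
    rw [← Real.exp_add]
    congr 1
    rw [hτ]; field_simp; ring
  have hQexp : Q < Real.exp (Q + 1) := by linarith [Real.add_one_le_exp (Q + 1)]
  have hQm : K * M ^ p * V = Q * (α * (M⁻¹) ^ p * b) := by
    rw [hQ, div_mul_cancel₀ _ (by positivity)]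
  rw [hexp]
  calc K * (M ^ p * (τ * ‖ρ‖) ^ p * Real.exp (p * (τ * t))) * V
      = (τ * ‖ρ‖) ^ p * Real.exp (p * (τ * t)) * (α * (M⁻¹) ^ p * b) * Q := by
        linear_combination (τ * ‖ρ‖) ^ p * Real.exp (p * (τ * t)) * hQm
    _ < (τ * ‖ρ‖) ^ p * Real.exp (p * (τ * t)) * (α * (M⁻¹) ^ p * b) * Real.exp (Q + 1) := by
        gcongr
    _ = _ := by ring

end Comparison

/-! ### Monotonicity tests and their converses -/

section Monotonicity

variable {n : ℕ} {Ω : Set (E n)} {p : ℝ} [hp : Fact (1 < p)] {σ : E n → ℝ}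

lemma isMinimizer_solution (hn : 2 ≤ n) (hΩ : IsOpen Ω) (hΩb : Bornology.IsBounded Ω)
    (hσ : IsConductivity Ω σ) (f : X Ω p) : IsMinimizer σ f (solution σ f) :=
  Classical.epsilon_spec (exists_isMinimizer hn hΩ hΩb hσ f)

lemma testOp_self (B : Set (E n)) (f : X Ω p) :
    testOp Ω p B f f = ∫ x in B, ‖grad (solution (fun _ => 1) f) x‖ ^ p := by
  rw [testOp, fluxForm_self]
  simp only [one_mul]

lemma opLE_add_testOp_iff (hn : 2 ≤ n) (hΩ : IsOpen Ω) (hΩb : Bornology.IsBounded Ω)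
    (hσ : IsConductivity Ω σ) (B : Set (E n)) (β : ℝ) :
    OpLE (dnOp Ω p (fun _ => 1) + β • testOp Ω p B) (dnOp Ω p σ) ↔
      ∀ f : X Ω p, energy (fun _ => 1) (solution (fun _ => 1) f) +
        β * ∫ x in B, ‖grad (solution (fun _ => 1) f) x‖ ^ p ≤ energy σ (solution σ f) := by
  refine forall_congr' fun f => ?_
  have h1 := dnMap_self hσ (exists_isMinimizer hn hΩ hΩb hσ f)
  have h2 := dnMap_self isConductivity_one (exists_isMinimizer hn hΩ hΩb isConductivity_one f)
  simp only [Pi.sub_apply, Pi.add_apply, Pi.smul_apply, smul_eq_mul]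
  rw [testOp_self, dnOp, dnOp, h1, h2, sub_nonneg]

lemma opLE_sub_testOp_iff (hn : 2 ≤ n) (hΩ : IsOpen Ω) (hΩb : Bornology.IsBounded Ω)
    (hσ : IsConductivity Ω σ) (B : Set (E n)) (β : ℝ) :
    OpLE (dnOp Ω p σ) (dnOp Ω p (fun _ => 1) - β • testOp Ω p B) ↔
      ∀ f : X Ω p, energy σ (solution σ f) ≤ energy (fun _ => 1) (solution (fun _ => 1) f) -
        β * ∫ x in B, ‖grad (solution (fun _ => 1) f) x‖ ^ p := by
  refine forall_congr' fun f => ?_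
  have h1 := dnMap_self hσ (exists_isMinimizer hn hΩ hΩb hσ f)
  have h2 := dnMap_self isConductivity_one (exists_isMinimizer hn hΩ hΩb isConductivity_one f)
  simp only [Pi.sub_apply, Pi.smul_apply, smul_eq_mul]
  rw [testOp_self, dnOp, dnOp, h1, h2, sub_nonneg]

lemma integral_sub_mul_setIntegral {B : Set (E n)} (hBΩ : B ⊆ Ω) (hB : NullMeasurableSet B volume)
    {g : E n → ℝ} (hg : Integrable g (volume.restrict Ω)) (β : ℝ) :
    Integrable (fun x => g x - β * B.indicator g x) (volume.restrict Ω) ∧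
    ∫ x in Ω, (g x - β * B.indicator g x) = (∫ x in Ω, g x) - β * ∫ x in B, g x := by
  have hi : Integrable (B.indicator g) (volume.restrict Ω) :=
    hg.indicator₀ (hB.mono_ac Measure.restrict_le_self.absolutelyContinuous)
  refine ⟨hg.sub (hi.const_mul β), ?_⟩
  rw [integral_sub hg (hi.const_mul β), integral_const_mul, setIntegral_eq_indicator hBΩ hB]

/-- Excludes the wrong sign of σ - 1 in the two direct tests. -/
lemma false_of_ae_restrict {B : Set (E n)} (hBΩ : B ⊆ Ω) (hBpos : 0 < volume B)
    {P Q : E n → Prop} (hP : ∀ᵐ x ∂(volume.restrict Ω), P x)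
    (hQ : ∀ᵐ x ∂(volume.restrict B), Q x) (hPQ : ∀ x, P x → ¬ Q x) : False := by
  have h : ∀ᵐ _ ∂((volume : Measure (E n)).restrict B), False := by
    filter_upwards [ae_restrict_of_ae_restrict_of_subset hBΩ hP, hQ] with x h1 h2
    exact hPQ x h1 h2
  rw [ae_iff] at h
  simp only [not_false_eq_true] at h
  exact hBpos.ne' (by simpa using h)

lemma one_sub_rpow_pos {p : ℝ} (hp : 1 < p) {α : ℝ} (hα : 0 < α) :
    0 < (p - 1) * (1 - (1 + α) ^ (-(1 / (p - 1)))) := by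
  have hp1 : 0 < p - 1 := by linarith
  have : (1 + α) ^ (-(1 / (p - 1))) < 1 :=
    Real.rpow_lt_one_of_one_lt_of_neg (by linarith) (by rw [neg_lt_zero]; positivity)
  exact mul_pos hp1 (by linarith)

/-- The lower monotonicity test: inclusions of higher conductivity. -/
lemma opLE_of_one_add_le (hn : 2 ≤ n) (hΩ : IsOpen Ω) (hΩb : Bornology.IsBounded Ω)
    (hσ : IsConductivity Ω σ) (hσ1 : ∀ᵐ x ∂(volume.restrict Ω), 1 ≤ σ x) {B : Set (E n)}
    (hBΩ : B ⊆ Ω) (hB : NullMeasurableSet B volume) {α : ℝ} (hα : 0 < α)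
    (hσB : ∀ᵐ x ∂(volume.restrict B), 1 + α ≤ σ x) :
    OpLE (dnOp Ω p (fun _ => 1) + ((p - 1) * (1 - (1 + α) ^ (-(1 / (p - 1))))) • testOp Ω p B)
      (dnOp Ω p σ) := by
  rw [opLE_add_testOp_iff hn hΩ hΩb hσ]
  intro f
  have hp1 : 0 < p - 1 := by linarith [hp.out]
  have hq : -(1 / (p - 1)) ≤ 0 := by rw [neg_nonpos]; positivity
  have hu := isMinimizer_solution hn hΩ hΩb isConductivity_one f
  have hv := isMinimizer_solution hn hΩ hΩb hσ f
  have h1 := hu.mul_energy_le hσ hv.1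
  generalize solution (fun _ => 1) f = u at hu h1 ⊢
  have hg := integrable_rpow_grad u
  obtain ⟨hi, he⟩ := integral_sub_mul_setIntegral hBΩ hB hg (1 - (1 + α) ^ (-(1 / (p - 1))))
  have h2 : ∫ x in Ω, σ x ^ (-(1 / (p - 1))) * ‖grad u x‖ ^ p ≤
      (∫ x in Ω, ‖grad u x‖ ^ p) -
        (1 - (1 + α) ^ (-(1 / (p - 1)))) * ∫ x in B, ‖grad u x‖ ^ p := by
    rw [← he]
    refine integral_mono_ae (hg.mul_of_top_right (hσ.memLp_rpow hq)) hi ?_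
    filter_upwards [hσ1, ae_restrict_of_ae_restrict_subset hBΩ hB hσB] with x hx1 hx2
    have hn : 0 ≤ ‖grad u x‖ ^ p := by positivity
    by_cases hxB : x ∈ B
    · have := mul_le_mul_of_nonneg_right
        (Real.rpow_le_rpow_of_nonpos (by linarith) (hx2 hxB) hq) hn
      simp only [indicator_of_mem hxB]
      linarith
    · have := mul_le_mul_of_nonneg_right (Real.rpow_le_one_of_one_le_of_nonpos hx1 hq) hn
      simp only [indicator_of_notMem hxB]
      linarith
  have h3 := mul_le_mul_of_nonneg_left h2 hp1.le
  rw [energy_one] at h1 ⊢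
  linarith

/-- The upper monotonicity test: inclusions of lower conductivity. -/
lemma opLE_of_le_one_sub (hn : 2 ≤ n) (hΩ : IsOpen Ω) (hΩb : Bornology.IsBounded Ω)
    (hσ : IsConductivity Ω σ) (hσ1 : ∀ᵐ x ∂(volume.restrict Ω), σ x ≤ 1) {B : Set (E n)}
    (hBΩ : B ⊆ Ω) (hB : NullMeasurableSet B volume) {α : ℝ}
    (hσB : ∀ᵐ x ∂(volume.restrict B), σ x ≤ 1 - α) :
    OpLE (dnOp Ω p σ) (dnOp Ω p (fun _ => 1) - α • testOp Ω p B) := by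
  rw [opLE_sub_testOp_iff hn hΩ hΩb hσ]
  intro f
  have hu := isMinimizer_solution hn hΩ hΩb isConductivity_one f
  have hv := isMinimizer_solution hn hΩ hΩb hσ f
  generalize solution (fun _ => 1) f = u at hu ⊢
  have hg := integrable_rpow_grad u
  obtain ⟨hi, he⟩ := integral_sub_mul_setIntegral hBΩ hB hg α
  -- The minimizer for conductivity 1 is a competitor for σ; what remains is a pointwise comparison
  -- of integrands.
  refine (hv.2 u hu.1).trans ?_
  rw [energy_one, ← he]
  refine integral_mono_ae (hσ.integrable_mul hg) hi ?_
  filter_upwards [hσ1, ae_restrict_of_ae_restrict_subset hBΩ hB hσB] with x hx1 hx2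
  have hn : 0 ≤ ‖grad u x‖ ^ p := by positivity
  by_cases hxB : x ∈ B
  · have := mul_le_mul_of_nonneg_right (hx2 hxB) hn
    simp only [indicator_of_mem hxB]
    linarith
  · have := mul_le_mul_of_nonneg_right hx1 hn
    simp only [indicator_of_notMem hxB]
    linarith

/-- If the energy in `B` of all solutions for the conductivity `1` is controlled by their energy on
the set where `σ ≠ 1`, then `B` lies in the hull of the essential support of `σ - 1`. -/
lemma measure_sdiff_cessco_eq_zero (hn : 2 ≤ n) (hΩ : IsOpen Ω) (hΩb : Bornology.IsBounded Ω)
    {B : Set (E n)} (hBΩ : B ⊆ Ω) (hB : NullMeasurableSet B volume) {α : ℝ} (hα : 0 < α)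
    {k : E n → ℝ} (hk : MemLp k ⊤ (volume.restrict Ω)) (hk0 : ∀ x, σ x = 1 → k x = 0)
    (h : ∀ f : X Ω p, α * ∫ x in B, ‖grad (solution (fun _ => 1) f) x‖ ^ p ≤
      ∫ x in Ω, k x * ‖grad (solution (fun _ => 1) f) x‖ ^ p) :
    volume (B \ cessco (essSupp Ω (fun x => |σ x - 1|))) = 0 := by
  by_contra hcon
  obtain ⟨ρ, t, t', hρ, htt, hσ1, hBt⟩ := exists_separating_halfSpace hn hΩb hBΩ hcon
  have hk1 : ∀ᵐ x ∂(volume.restrict Ω), t < inner ℝ x ρ → k x = 0 := by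
    rw [ae_restrict_iff' hΩ.measurableSet]
    filter_upwards [hσ1] with x hx hxΩ hxt using hk0 x (hx hxΩ hxt)
  obtain ⟨u, hu, hlt⟩ := exists_concentrating_solution (p := p) hn hΩ hΩb hBΩ hB hα hρ htt hBt
    hk hk1
  have hs := isMinimizer_solution hn hΩ hΩb isConductivity_one (trace u)
  have hgr := hu.grad_ae_eq isConductivity_one hs
  have h1 := h (trace u)
  generalize solution (fun _ => 1) (trace u) = v at hs hgr h1
  have e1 : ∫ x in B, ‖grad v x‖ ^ p = ∫ x in B, ‖grad u x‖ ^ p := by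
    refine integral_congr_ae ?_
    filter_upwards [ae_restrict_of_ae_restrict_of_subset hBΩ hgr] with x hx
    rw [hx]
  have e2 : ∫ x in Ω, k x * ‖grad v x‖ ^ p = ∫ x in Ω, k x * ‖grad u x‖ ^ p := by
    refine integral_congr_ae ?_
    filter_upwards [hgr] with x hx
    rw [hx]
  rw [e1, e2] at h1
  exact absurd hlt (not_lt.2 h1)

/-- Using u as a competitor bounds the energy gain by ∫ (σ - 1)|∇u|^p, so the weight is k = σ - 1.
-/
lemma measure_sdiff_cessco_eq_zero_of_add_le (hn : 2 ≤ n) (hΩ : IsOpen Ω)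
    (hΩb : Bornology.IsBounded Ω) (hσ : IsConductivity Ω σ) {B : Set (E n)} (hBΩ : B ⊆ Ω)
    (hB : NullMeasurableSet B volume) {α : ℝ} (hα : 0 < α)
    (h : OpLE (dnOp Ω p (fun _ => 1) + α • testOp Ω p B) (dnOp Ω p σ)) :
    volume (B \ cessco (essSupp Ω (fun x => |σ x - 1|))) = 0 := by
  rw [opLE_add_testOp_iff hn hΩ hΩb hσ] at h
  have hfin : IsFiniteMeasure (volume.restrict Ω) := ⟨by simpa using hΩb.measure_lt_top⟩
  refine measure_sdiff_cessco_eq_zero (p := p) hn hΩ hΩb hBΩ hB hα (k := fun x => σ x - 1)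
    (hσ.1.sub (memLp_top_const 1)) (fun x hx => by rw [hx, sub_self]) fun f => ?_
  have hu := isMinimizer_solution hn hΩ hΩb isConductivity_one f
  have hv := isMinimizer_solution hn hΩ hΩb hσ f
  have h1 := h f
  generalize solution (fun _ => 1) f = u at hu h1 ⊢
  have h2 := hv.2 u hu.1
  have hg := integrable_rpow_grad u
  simp only [sub_mul, one_mul]
  rw [integral_sub (hσ.integrable_mul hg) hg, ← energy_one]
  exact le_sub_iff_add_le'.2 (h1.trans h2)

/-- Here the energy loss is bounded through Young's inequality, which gives the weight k =
(p-1)(σ^{-1/(p-1)} - 1). -/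
lemma measure_sdiff_cessco_eq_zero_of_le_sub (hn : 2 ≤ n) (hΩ : IsOpen Ω)
    (hΩb : Bornology.IsBounded Ω) (hσ : IsConductivity Ω σ) {B : Set (E n)} (hBΩ : B ⊆ Ω)
    (hB : NullMeasurableSet B volume) {α : ℝ} (hα : 0 < α)
    (h : OpLE (dnOp Ω p σ) (dnOp Ω p (fun _ => 1) - α • testOp Ω p B)) :
    volume (B \ cessco (essSupp Ω (fun x => |σ x - 1|))) = 0 := by
  rw [opLE_sub_testOp_iff hn hΩ hΩb hσ] at h
  have hfin : IsFiniteMeasure (volume.restrict Ω) := ⟨by simpa using hΩb.measure_lt_top⟩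
  have hp1 : 0 < p - 1 := by linarith [hp.out]
  have hq : -(1 / (p - 1)) ≤ 0 := by rw [neg_nonpos]; positivity
  have hs := hσ.memLp_rpow hq
  refine measure_sdiff_cessco_eq_zero (p := p) hn hΩ hΩb hBΩ hB hα
    (k := fun x => (p - 1) * (σ x ^ (-(1 / (p - 1))) - 1))
    ((hs.sub (memLp_top_const 1)).const_mul _)
    (fun x hx => by rw [hx, Real.one_rpow, sub_self, mul_zero]) fun f => ?_
  have hu := isMinimizer_solution hn hΩ hΩb isConductivity_one f
  have hv := isMinimizer_solution hn hΩ hΩb hσ f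
  have h1 := h f
  have h2 := hu.mul_energy_le hσ hv.1
  generalize solution (fun _ => 1) f = u at hu h1 h2 ⊢
  have hg := integrable_rpow_grad u
  have h3 : ∫ x in Ω, (σ x ^ (-(1 / (p - 1))) - 1) * ‖grad u x‖ ^ p =
      (∫ x in Ω, σ x ^ (-(1 / (p - 1))) * ‖grad u x‖ ^ p) - energy (fun _ => 1) u := by
    have hi : Integrable (fun x => σ x ^ (-(1 / (p - 1))) * ‖grad u x‖ ^ p)
        (volume.restrict Ω) := hg.mul_of_top_right hs
    simp only [sub_mul, one_mul]
    rw [integral_sub hi hg, ← energy_one]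
  simp only [mul_assoc (p - 1)]
  rw [integral_const_mul, h3]
  linarith

end Monotonicity

end PCalderon

end

/-! ### The main theorem -/

open PCalderon
theorem theorem3p1 {n : ℕ} (hn : 2 ≤ n) (p : ℝ) [hp : Fact (1 < p)]
    (Ω : Set (E n)) (hΩ : IsOpen Ω) (hΩb : Bornology.IsBounded Ω)
    (σ : E n → ℝ) (hσ : IsConductivity Ω σ)
    (hmono : (∀ᵐ x ∂(volume.restrict Ω), 1 ≤ σ x) ∨ (∀ᵐ x ∂(volume.restrict Ω), σ x ≤ 1))
    (B : Set (E n)) (hBΩ : B ⊆ Ω) (hB : NullMeasurableSet B volume) (hBpos : 0 < volume B)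
    (α : ℝ) (hα : 0 < α) :
    (0 < (p - 1) * (1 - (1 + α) ^ (-(1 / (p - 1)))) ∧
      ((∀ᵐ x ∂(volume.restrict B), 1 + α ≤ σ x) →
        OpLE (dnOp Ω p (fun _ => 1) +
            ((p - 1) * (1 - (1 + α) ^ (-(1 / (p - 1))))) • testOp Ω p B)
          (dnOp Ω p σ))) ∧
    ((∀ᵐ x ∂(volume.restrict B), σ x ≤ 1 - α) →
      OpLE (dnOp Ω p σ) (dnOp Ω p (fun _ => 1) - α • testOp Ω p B)) ∧
    (OpLE (dnOp Ω p (fun _ => 1) + α • testOp Ω p B) (dnOp Ω p σ) →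
      volume (B \ cessco (essSupp Ω (fun x => |σ x - 1|))) = 0) ∧
    (OpLE (dnOp Ω p σ) (dnOp Ω p (fun _ => 1) - α • testOp Ω p B) →
      volume (B \ cessco (essSupp Ω (fun x => |σ x - 1|))) = 0) := by
  refine ⟨⟨one_sub_rpow_pos hp.out hα, fun hσB => ?_⟩, fun hσB => ?_,
    measure_sdiff_cessco_eq_zero_of_add_le hn hΩ hΩb hσ hBΩ hB hα,
    measure_sdiff_cessco_eq_zero_of_le_sub hn hΩ hΩb hσ hBΩ hB hα⟩
  · rcases hmono with h | h
    · exact opLE_of_one_add_le hn hΩ hΩb hσ h hBΩ hB hα hσB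
    -- σ ≤ 1 is incompatible with σ ≥ 1 + α on the non-null set `B`.
    · exact (false_of_ae_restrict hBΩ hBpos h hσB fun x h1 h2 => by linarith).elim
  · rcases hmono with h | h
    · exact (false_of_ae_restrict hBΩ hBpos h hσB fun x h1 h2 => by linarith).elim
    · exact opLE_of_le_one_sub hn hΩ hΩb hσ h hBΩ hB hσB
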